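/- Let $S\ge 1$, $d\ge 0$ be integers, $\mathcal X=[S]^d$, with addition on $[S]$ modulo $S$; for $x\in\mathcal X$ and $c\in[S]$ let $x\oplus_i c$ be $x$ with $c$ added to its $i$-th coordinate. The uniform noising process started from a distribution $q_0$ on $\mathcal X$ is the continuous-time Markov chain $(X_t)_{t\ge0}$ on $\mathcal X$ with $X_0\sim q_0$ and rate $Q(x,y)=1/S$ if $x,y$ differ in exactly one coordinate, $Q(x,y)=0$ if they differ in at least two. Let $q_t$ be the law of $X_t$ and $s_t(y,x)=q_t(y)/q_t(x)$. Write $\mathcal H$ for the Shannon entropy and, for $\gamma\in[0,1]$, let $\mathcal P^\gamma(\mathcal X)$ be the set of distributions $q_0$ on $\mathcal X$ with $\mathcal H(q_1)\le(1-\gamma)\,d\log S$. Given $T$, $\delta\ge 0$, $N\ge1$, a schedule $0=t_0<t_1<\dots<t_N=T-\delta$ and nonnegative score estimates $\widehat s_{T-t_k}(y,x)$, the $\tau$-leaping sampler $(x_t)_{t\in[0,T-\delta]}$ starts from the uniform distribution on $\mathcal X$ and, on each $[t_k,t_{k+1}]$, given the history up to $t_k$, lets the $d$ coordinates evolve as independent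 time-homogeneous continuous-time Markov chains on $[S]$ started at $x_{t_k}^1,\dots,x_{t_k}^d$, the $i$-th one with jump rates $a\to b$ ($a\ne b$) equal to $\frac1S\,\widehat s_{T-t_k}\big(x_{t_k}\oplus_i(b-a),\,x_{t_k}\big)$. Let $P$ be its path measure, and let $\overleftarrow Q$ be the path measure on $[0,T-\delta]$ of the backward process, i.e. the time reversal $(X_{T-t})_{t\in[0,T-\delta]}$ of the noising process. Let $$\varepsilon_{\rm score}=\sum_{k=0}^{N-1}(t_{k+1}-t_k)\,\mathbb E_{x\sim q_{T-t_k}}\Big[\sum_{y\ne x}Q(y,x)\,s_{T-t_k}(y,x)\,D\big(\widehat s_{T-t_k}(y,x),s_{T-t_k}(y,x)\big)\Big],\qquad D(a,b)=\tfrac ab-1-\log\tfrac ab,$$ with $D(0,b)=\infty$, be the aggregated score-entropy error, assumed finite. Theorem. For all constants $\gamma_0>0$, $C\ge0$ and $\delta_0<1$ there is a constant $c>0$, depending only on $\gamma_0,C,\delta_0$, such that for all $S,d$, all $\gamma\in[\gamma_0,1]$, every $q_0\in\mathcal P^\gamma(\mathcal X)$, all $T$ and all $0\le\delta\le\delta_0$,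 every schedule $0=t_0<\dots<t_N=T-\delta$ with $\max_k(t_{k+1}-t_k)\le\frac12$, and all score estimates as above: if $$\mathsf{KL}(\overleftarrow Q\,\|\,P)\le\varepsilon_{\rm score}+C,$$ then $N\ge c\,d\log S$. -/

import Mathlib

open MeasureTheory Filter Topology
open scoped NNReal ENNReal

noncomputable section

namespace UniformDiffusion

/-! ### Paths and continuous-time Markov chains on a finite state space -/

/-- Right-continuity with left limits for a path with values in a discrete space. -/
def IsCadlag {α : Type*} {τ : ℝ} (ω : Set.Icc (0 : ℝ) τ → α) : Prop :=
  ∀ t, (∀ᶠ u in 𝓝[>] t, ω u = ω t) ∧ ∃ x, ∀ᶠ u in 𝓝[<] t, ω u = x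

/-- The path space over the time interval `[0, τ]`. It carries the σ-algebra generated by the
evaluations (the subtype instance of the product σ-algebra). -/
abbrev Path (α : Type*) (τ : ℝ) : Type _ :=
  {ω : Set.Icc (0 : ℝ) τ → α // IsCadlag ω}

/-- The σ-algebra generated by the path up to time `s`. -/
@[reducible] def history (α : Type*) [MeasurableSpace α] (τ : ℝ) (s : Set.Icc (0 : ℝ) τ) :
    MeasurableSpace (Path α τ) :=
  ⨆ r : {r : Set.Icc (0 : ℝ) τ // r ≤ s},
    MeasurableSpace.comap (fun ω : Path α τ => ω.1 r.1) inferInstance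

/-- The rate matrix with off-diagonal entries `r` (its rows sum to zero). -/
def rateMatrix {α : Type*} [Fintype α] [DecidableEq α] (r : α → α → ℝ) : Matrix α α ℝ :=
  fun x y => if x = y then -∑ z ∈ Finset.univ.erase x, r x z else r x y

/-- The transition matrix `exp (h • A)` over a time span `h` of the time-homogeneous chain with
rate matrix `A`. -/
def transition {α : Type*} [Fintype α] [DecidableEq α] (A : Matrix α α ℝ) (h : ℝ) :
    Matrix α α ℝ :=
  NormedSpace.exp (h • A)

/-- `μ` is the path law on `[0, τ]` of the time-homogeneous continuous-time Markov chain with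
initial distribution `init` and rate matrix `A`: given the history up to time `s`, the state at
time `u ≥ s` is `b` with probability `exp ((u - s) A) (ω s) b`. -/
structure IsCTMC {α : Type*} [Fintype α] [DecidableEq α] [MeasurableSpace α] {τ : ℝ}
    (init : α → ℝ) (A : Matrix α α ℝ) (μ : Measure (Path α τ)) : Prop where
  isProbabilityMeasure : IsProbabilityMeasure μ
  initial : ∀ r : Set.Icc (0 : ℝ) τ, (r : ℝ) = 0 →
    ∀ x, μ {ω | ω.1 r = x} = ENNReal.ofReal (init x)
  markov : ∀ s u : Set.Icc (0 : ℝ) τ, s ≤ u →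
    ∀ H : Set (Path α τ), MeasurableSet[history α τ s] H → ∀ a b : α,
      μ (H ∩ {ω | ω.1 s = a} ∩ {ω | ω.1 u = b}) =
        μ (H ∩ {ω | ω.1 s = a}) * ENNReal.ofReal (transition A ((u : ℝ) - (s : ℝ)) a b)

/-- `ν` is the law on `[0, τ]` of the time reversal `t ↦ X (T - t)` of the process `X` on `[0, T]`
with law `μ` (right-continuous version: all finite-dimensional distributions agree). -/
def IsTimeReversal {α : Type*} [MeasurableSpace α] {T τ : ℝ}
    (μ : Measure (Path α T)) (ν : Measure (Path α τ)) : Prop :=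
  ∀ (n : ℕ) (u : Fin n → Set.Icc (0 : ℝ) τ) (v : Fin n → Set.Icc (0 : ℝ) T),
    (∀ j, (v j : ℝ) = T - (u j : ℝ)) →
      ν.map (fun ω j => ω.1 (u j)) = μ.map (fun ω j => ω.1 (v j))

/-! ### The uniform noising process on `[S]^d` -/

/-- The state space `[S]^d`. -/
abbrev State (S d : ℕ) : Type := Fin d → Fin S

/-- `shift x i c` adds `c` modulo `S` to the `i`-th coordinate of `x`. -/
def shift {S d : ℕ} (x : State S d) (i : Fin d) (c : Fin S) : State S d :=
  Function.update x i (x i + c)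

/-- The rate matrix of the uniform noising process: rate `1 / S` between any two states that
differ in exactly one coordinate. -/
def uniformRate (S d : ℕ) : Matrix (State S d) (State S d) ℝ :=
  rateMatrix fun x y => if hammingDist x y = 1 then 1 / (S : ℝ) else 0

/-- The marginal `q_t` of the uniform noising process started from `q₀`. -/
def marginal {S d : ℕ} (q₀ : State S d → ℝ) (t : ℝ) (x : State S d) : ℝ :=
  ∑ x₀, q₀ x₀ * transition (uniformRate S d) t x₀ x

/-- Shannon entropy (in nats). -/
def entropy {α : Type*} [Fintype α] (q : α → ℝ) : ℝ :=
  ∑ x, Real.negMulLog (q x)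

/-- The class of targets whose noised marginal at time `1` has entropy at most
`(1 - γ) d log S`. -/
def lowEntropyClass (S d : ℕ) (γ : ℝ) : Set (State S d → ℝ) :=
  {q₀ | q₀ ∈ stdSimplex ℝ (State S d) ∧
    entropy (marginal q₀ 1) ≤ (1 - γ) * ((d : ℝ) * Real.log S)}

/-- The score `s_t(y, x) = q_t(y) / q_t(x)`. -/
def score {S d : ℕ} (q₀ : State S d → ℝ) (t : ℝ) (y x : State S d) : ℝ :=
  marginal q₀ t y / marginal q₀ t x

/-- The Bregman divergence `D(a, b) = a / b - 1 - log (a / b)`, infinite on the boundary. -/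
def bregman (a b : ℝ) : ℝ≥0∞ :=
  if 0 < a ∧ 0 < b then ENNReal.ofReal (a / b - 1 - Real.log (a / b)) else ⊤

/-- The score entropy loss at time `t` of the estimate `sh` of the score:
`E_{x ∼ q_t} ∑_{y ≠ x} Q(y, x) s_t(y, x) D(sh(y, x), s_t(y, x))`. -/
def scoreEntropyLoss {S d : ℕ} (q₀ : State S d → ℝ) (t : ℝ)
    (sh : State S d → State S d → ℝ≥0) : ℝ≥0∞ :=
  ∑ x, ENNReal.ofReal (marginal q₀ t x) *
    ∑ y ∈ Finset.univ.erase x,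
      ENNReal.ofReal (uniformRate S d y x * score q₀ t y x) * bregman (sh y x) (score q₀ t y x)

/-- The aggregated score estimation error `∑_k (t_{k+1} - t_k) L_SE(T - t_k)`. -/
def aggregatedLoss {S d N : ℕ} (q₀ : State S d → ℝ) (T : ℝ) (t : Fin (N + 1) → ℝ)
    (sh : ℝ → State S d → State S d → ℝ≥0) : ℝ≥0∞ :=
  ∑ k : Fin N, ENNReal.ofReal (t k.succ - t k.castSucc) *
    scoreEntropyLoss q₀ (T - t k.castSucc) (sh (T - t k.castSucc))

/-! ### The `τ`-leaping sampler -/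

/-- The rate matrix of the one-dimensional chain which moves coordinate `i` during one leap that
starts from the state `z`: the jump `a → b` has rate `(1 / S) * sh(z ⊕_i (b - a), z)`. -/
def leapRate {S d : ℕ} (sh : State S d → State S d → ℝ≥0) (z : State S d) (i : Fin d) :
    Matrix (Fin S) (Fin S) ℝ :=
  rateMatrix fun a b => 1 / (S : ℝ) * (sh (shift z i (b - a)) z : ℝ)

/-- `μ` is the path law of the `τ`-leaping sampler with score estimates `sh (T - t k)` on the grid
`t`: it starts from the uniform distribution, and on `[t k, t (k + 1)]`, given the state `z` at
time `t k`, the coordinates evolve as independent chains with rate matrices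
`leapRate (sh (T - t k)) z i`. -/
structure IsTauLeaping {S d N : ℕ} (T : ℝ) (t : Fin (N + 1) → ℝ)
    (sh : ℝ → State S d → State S d → ℝ≥0) {τ : ℝ} (μ : Measure (Path (State S d) τ)) : Prop where
  isProbabilityMeasure : IsProbabilityMeasure μ
  initial : ∀ r : Set.Icc (0 : ℝ) τ, (r : ℝ) = 0 →
    ∀ x, μ {ω | ω.1 r = x} = ENNReal.ofReal (1 / (S : ℝ) ^ d)
  leap : ∀ (k : Fin N) (r s u : Set.Icc (0 : ℝ) τ),
    (r : ℝ) = t k.castSucc → r ≤ s → s ≤ u → (u : ℝ) ≤ t k.succ →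
    ∀ H : Set (Path (State S d) τ), MeasurableSet[history (State S d) τ s] H →
    ∀ z a b : State S d,
      μ (H ∩ {ω | ω.1 r = z} ∩ {ω | ω.1 s = a} ∩ {ω | ω.1 u = b}) =
        μ (H ∩ {ω | ω.1 r = z} ∩ {ω | ω.1 s = a}) *
          ENNReal.ofReal (∏ i, transition (leapRate (sh (T - t k.castSucc)) z i)
            ((u : ℝ) - (s : ℝ)) (a i) (b i))

end UniformDiffusion

end

noncomputable section

namespace UniformDiffusion

section

/-! ### Transition matrices -/

section Transition

variable {α : Type*} [Fintype α] [DecidableEq α]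

/-! Let H(t) be the relative entropy of `q_t` to the uniform law (`relEntropy`), I(t) = -H'(t) its
production (`fisherInfo`), L = d log S, u_k = T - t_k the noise levels of the schedule and h_k the
step lengths.

During a leap the jump rates of the sampler depend only on the state at its start. Given that same
state, the expected jump rates of the backward process stay equal to the scores at level u_k
throughout the leap, because noise is translation invariant (`sum_backward_increment`). Restricting
both path laws to a grid (data processing), computing the divergence there and letting the mesh tend
to zero therefore gives KL ≥ H(δ) + ε_score - Σ h_k I(u_k). Under the hypothesis on KL, the Riemann
sum Σ h_k I(u_k) falls short of H(δ) by at most C (`relEntropy_sub_sum_fisherInfo_le`).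

A coarse Riemann sum cannot be that accurate. A noised coordinate is kept with probability e^{-s}
and otherwise resampled, so strong data processing gives I(t + s) ≤ e^{-s} I(t)
(`fisherInfo_add_le`). Within a step I thus grows at least exponentially as the noise level falls,
and the step loses at least h_k² I(u_k) / 2 (`relEntropy_sub_ge`). Hence Σ h_k² I(u_k) ≤ 2C. On the
other hand the levels above 1, where I ≤ L (`fisherInfo_le`), carry entropy H(1) ≥ γL. Balancing h I
against h² I by the arithmetic-geometric mean inequality forces N to be at least of order γ² L / (C
+ 1) (`card_steps_ge`). -/

lemma transition_zero (A : Matrix α α ℝ) : transition A 0 = 1 := by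
  simp [transition]

lemma transition_add (A : Matrix α α ℝ) (s t : ℝ) :
    transition A (s + t) = transition A s * transition A t := by
  unfold transition
  rw [add_smul]
  exact Matrix.exp_add_of_commute _ _ ((Commute.refl A).smul_left s |>.smul_right t)

lemma hasDerivAt_transition (A : Matrix α α ℝ) (a b : α) (t : ℝ) :
    HasDerivAt (fun t => transition A t a b) ((transition A t * A) a b) t := by
  let _ : NormedRing (Matrix α α ℝ) := Matrix.linftyOpNormedRing
  let _ : NormedAlgebra ℝ (Matrix α α ℝ) := Matrix.linftyOpNormedAlgebra
  have h := hasDerivAt_exp_smul_const (𝕂 := ℝ) A t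
  exact (LinearMap.toContinuousLinearMap
    (Matrix.entryLinearMap ℝ ℝ a b)).hasFDerivAt.comp_hasDerivAt t h

lemma hasDerivAt_transition' (A : Matrix α α ℝ) (a b : α) (t : ℝ) :
    HasDerivAt (fun t => transition A t a b) ((A * transition A t) a b) t := by
  let _ : NormedRing (Matrix α α ℝ) := Matrix.linftyOpNormedRing
  let _ : NormedAlgebra ℝ (Matrix α α ℝ) := Matrix.linftyOpNormedAlgebra
  have h := hasDerivAt_exp_smul_const' (𝕂 := ℝ) A t
  exact (LinearMap.toContinuousLinearMap
    (Matrix.entryLinearMap ℝ ℝ a b)).hasFDerivAt.comp_hasDerivAt t h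

lemma hasDerivAt_transition_zero (A : Matrix α α ℝ) (a b : α) :
    HasDerivAt (fun t => transition A t a b) (A a b) 0 := by
  simpa [transition_zero] using hasDerivAt_transition A a b 0

/-- Conjugation by a permutation matrix is a continuous algebra automorphism, so it commutes with
the exponential. Used for translations of `Fin S`, under which the rates of a leap are invariant. -/
lemma transition_equiv (A : Matrix α α ℝ) (σ : α ≃ α) (h : ∀ a b, A (σ a) (σ b) = A a b)
    (t : ℝ) (a b : α) : transition A t (σ a) (σ b) = transition A t a b := by
  let _ : NormedRing (Matrix α α ℝ) := Matrix.linftyOpNormedRing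
  let _ : NormedAlgebra ℝ (Matrix α α ℝ) := Matrix.linftyOpNormedAlgebra
  let _ : NormedAlgebra ℚ (Matrix α α ℝ) := NormedAlgebra.restrictScalars ℚ ℝ _
  have hA : Matrix.reindexAlgEquiv ℝ ℝ σ.symm (t • A) = t • A := by
    ext a b
    simp [h]
  have hc : Continuous (Matrix.reindexAlgEquiv ℝ ℝ σ.symm : Matrix α α ℝ ≃ₐ[ℝ] Matrix α α ℝ) :=
    (Matrix.reindexAlgEquiv ℝ ℝ σ.symm).toLinearMap.continuous_of_finiteDimensional
  have hm := NormedSpace.map_exp (Matrix.reindexAlgEquiv ℝ ℝ σ.symm) hc (t • A)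
  rw [hA] at hm
  have := congrFun (congrFun hm a) b
  exact this

/-- The solution of the forward equation is the matrix exponential. -/
lemma eq_transition_of_hasDerivAt (A : Matrix α α ℝ) (P : ℝ → Matrix α α ℝ) (h0 : P 0 = 1)
    (hP : ∀ t a b, HasDerivAt (fun t => P t a b) ((P t * A) a b) t) (t : ℝ) :
    P t = transition A t := by
  -- The forward equation gives this product zero derivative, so it keeps its value at time 0.
  have key : ∀ t, P t * transition A (-t) = 1 := by
    intro t
    ext a b
    have hd : ∀ s, HasDerivAt (fun s => (P s * transition A (-s)) a b) 0 s := by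
      intro s
      simp only [Matrix.mul_apply]
      have h1 : ∀ c ∈ Finset.univ, HasDerivAt (fun s => P s a c * transition A (-s) c b)
          ((P s * A) a c * transition A (-s) c b
            + P s a c * (-(A * transition A (-s)) c b)) s := by
        intro c _
        refine (hP s a c).mul ?_
        have := (hasDerivAt_transition' A c b (-s)).scomp s (hasDerivAt_neg s)
        simpa [Function.comp_def] using this
      refine (HasDerivAt.fun_sum h1).congr_deriv ?_
      rw [Finset.sum_add_distrib]
      have h3 : ∑ c, (P s * A) a c * transition A (-s) c b
          = (P s * A * transition A (-s)) a b := (Matrix.mul_apply).symm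
      have h4 : ∑ c, P s a c * (-(A * transition A (-s)) c b)
          = -(P s * (A * transition A (-s))) a b := by
        rw [Matrix.mul_apply, ← Finset.sum_neg_distrib]
        exact Finset.sum_congr rfl fun c _ => by ring
      rw [h3, h4, Matrix.mul_assoc, add_neg_cancel]
    have hconst := is_const_of_deriv_eq_zero (fun s => (hd s).differentiableAt)
      (fun s => (hd s).deriv) t 0
    refine hconst.trans ?_
    simp [h0, transition_zero]
  calc P t = P t * transition A (-t + t) := by simp [transition_zero]
    _ = P t * transition A (-t) * transition A t := by rw [transition_add, Matrix.mul_assoc]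
    _ = transition A t := by rw [key, Matrix.one_mul]

end Transition

/-! ### The uniform noising kernel -/

variable {S d : ℕ} [NeZero S]

lemma shift_eq (x : State S d) (i : Fin d) (c : Fin S) : shift x i c = x + Pi.single i c := by
  ext j
  by_cases h : j = i
  · subst h; simp [shift]
  · simp [shift, h]

lemma hammingDist_add_single (x : State S d) (i : Fin d) {c : Fin S} (hc : c ≠ 0) :
    hammingDist (x + Pi.single i c) x = 1 := by
  unfold hammingDist
  rw [Finset.card_eq_one]
  refine ⟨i, ?_⟩
  ext j
  by_cases h : j = i
  · subst h; simp [hc]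
  · simp [h]

lemma sum_neighbors {M : Type*} [AddCommMonoid M] (x : State S d) (f : State S d → M) :
    ∑ y with hammingDist y x = 1, f y
      = ∑ i, ∑ c ∈ Finset.univ.erase (0 : Fin S), f (x + Pi.single i c) := by
  rw [← Finset.sum_product', eq_comm]
  refine Finset.sum_bij (fun p _ => x + Pi.single p.1 p.2) ?_ ?_ ?_ ?_
  · rintro ⟨i, c⟩ h
    simp only [Finset.mem_product, Finset.mem_univ, Finset.mem_erase, true_and, and_true] at h
    simpa using hammingDist_add_single x i h
  · rintro ⟨i, c⟩ h ⟨j, c'⟩ h' he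
    simp only [Finset.mem_product, Finset.mem_univ, Finset.mem_erase, true_and, and_true] at h h'
    have he' := add_left_cancel he
    have hij : i = j := by
      by_contra hne
      have := congrFun he' i
      simp [hne] at this
      exact h this
    subst hij
    simpa using he'
  · intro y hy
    simp only [Finset.mem_filter, Finset.mem_univ, true_and, hammingDist,
      Finset.card_eq_one] at hy
    obtain ⟨i, hi⟩ := hy
    have hmem : ∀ j, y j ≠ x j ↔ j = i := by
      intro j
      have := Finset.ext_iff.mp hi j
      simpa using this
    refine ⟨(i, y i - x i), ?_, ?_⟩
    · simpa [sub_eq_zero] using (hmem i).2 rfl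
    · ext j
      by_cases h : j = i
      · subst h; simp
      · have : y j = x j := by
          by_contra hne
          exact h ((hmem j).1 hne)
        simp [h, this]
  · intro _ _; rfl

omit [NeZero S] in
lemma uniformRate_of_ne {x y : State S d} (h : x ≠ y) :
    uniformRate S d x y = if hammingDist x y = 1 then 1 / (S : ℝ) else 0 := by
  simp [uniformRate, rateMatrix, h]

/-- The diagonal entry turns the sum over neighbours into a sum of differences. The vanishing terms
`c = 0` are kept so that `c` ranges over a whole group and translations can reindex the sum. -/
lemma sum_mul_uniformRate (f : State S d → ℝ) (x : State S d) :
    ∑ y, f y * uniformRate S d y x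
      = 1 / (S : ℝ) * ∑ i, ∑ c : Fin S, (f (x + Pi.single i c) - f x) := by
  have hsum : ∀ g : State S d → ℝ,
      ∑ y ∈ Finset.univ.erase x, (if hammingDist y x = 1 then g y else 0)
        = ∑ i, ∑ c ∈ Finset.univ.erase (0 : Fin S), g (x + Pi.single i c) := by
    intro g
    rw [← sum_neighbors x g, Finset.sum_filter]
    refine Finset.sum_subset (Finset.erase_subset _ _) ?_
    intro y _ hy
    have : y = x := by simpa using hy
    simp [this]
  have hdiag : uniformRate S d x x = -∑ i : Fin d, ∑ c ∈ Finset.univ.erase (0 : Fin S),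
      1 / (S : ℝ) := by
    rw [← hsum (fun _ => 1 / (S : ℝ))]
    simp only [uniformRate, rateMatrix, if_true, hammingDist_comm x]
  rw [← Finset.add_sum_erase Finset.univ (fun y => f y * uniformRate S d y x)
    (Finset.mem_univ x), hdiag]
  have : ∑ y ∈ Finset.univ.erase x, f y * uniformRate S d y x
      = ∑ i, ∑ c ∈ Finset.univ.erase (0 : Fin S), 1 / (S : ℝ) * f (x + Pi.single i c) := by
    rw [← hsum fun y => 1 / (S : ℝ) * f y]
    refine Finset.sum_congr rfl fun y hy => ?_
    rw [uniformRate_of_ne (Finset.ne_of_mem_erase hy)]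
    split_ifs <;> ring
  have hz : ∀ i : Fin d, ∑ c : Fin S, (f (x + Pi.single i c) - f x)
      = ∑ c ∈ Finset.univ.erase (0 : Fin S), (f (x + Pi.single i c) - f x) :=
    fun i => (Finset.sum_erase _ (by simp)).symm
  simp only [this, hz, mul_neg, Finset.mul_sum, Finset.sum_sub_distrib, mul_sub]
  rw [neg_add_eq_sub]
  simp only [mul_comm]

/-- The law at time `t` of the increment of one coordinate of the noising process. -/
def coordLaw (S : ℕ) [NeZero S] (t : ℝ) (c : Fin S) : ℝ :=
  (if c = 0 then Real.exp (-t) else 0) + (1 - Real.exp (-t)) / S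

/-- The law at time `t` of the increment of the noising process. -/
def incrementLaw (S d : ℕ) [NeZero S] (t : ℝ) (e : State S d) : ℝ :=
  ∏ i, coordLaw S t (e i)

lemma natCast_pos_of_neZero : (0 : ℝ) < S := by
  exact_mod_cast Nat.pos_of_ne_zero (NeZero.ne S)

lemma sum_coordLaw (t : ℝ) : ∑ c, coordLaw S t c = 1 := by
  have := natCast_pos_of_neZero (S := S)
  simp only [coordLaw, Finset.sum_add_distrib, Finset.sum_ite_eq', Finset.mem_univ, if_true,
    Finset.sum_const, Finset.card_univ, Fintype.card_fin, nsmul_eq_mul]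
  field_simp
  ring

lemma coordLaw_neg (t : ℝ) (c : Fin S) : coordLaw S t (-c) = coordLaw S t c := by
  simp [coordLaw]

lemma coordLaw_nonneg {t : ℝ} (ht : 0 ≤ t) (c : Fin S) : 0 ≤ coordLaw S t c := by
  have h1 : Real.exp (-t) ≤ 1 := by simpa using ht
  unfold coordLaw
  have h2 : 0 ≤ (1 - Real.exp (-t)) / S := div_nonneg (by linarith) (by positivity)
  split_ifs
  · have := Real.exp_pos (-t); linarith
  · linarith

lemma coordLaw_pos {t : ℝ} (ht : 0 < t) (c : Fin S) : 0 < coordLaw S t c := by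
  have h1 : Real.exp (-t) < 1 := by simpa using ht
  unfold coordLaw
  have h2 : 0 < (1 - Real.exp (-t)) / S :=
    div_pos (by linarith) natCast_pos_of_neZero
  split_ifs
  · have := Real.exp_pos (-t); linarith
  · linarith

lemma hasDerivAt_coordLaw (t : ℝ) (c : Fin S) :
    HasDerivAt (fun t => coordLaw S t c) (1 / S - coordLaw S t c) t := by
  unfold coordLaw
  have h : HasDerivAt (fun t : ℝ => Real.exp (-t)) (-Real.exp (-t)) t :=
    ((Real.hasDerivAt_exp (-t)).comp t (hasDerivAt_neg t)).congr_deriv (by ring)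
  split_ifs with hc
  · exact (h.add ((h.const_sub 1).div_const (S : ℝ))).congr_deriv (by ring)
  · exact (((h.const_sub 1).div_const (S : ℝ)).const_add 0).congr_deriv (by ring)

lemma incrementLaw_neg (t : ℝ) (e : State S d) : incrementLaw S d t (-e) = incrementLaw S d t e := by
  simp [incrementLaw, coordLaw_neg]

lemma incrementLaw_nonneg {t : ℝ} (ht : 0 ≤ t) (e : State S d) : 0 ≤ incrementLaw S d t e :=
  Finset.prod_nonneg fun _ _ => coordLaw_nonneg ht _

lemma incrementLaw_pos {t : ℝ} (ht : 0 < t) (e : State S d) : 0 < incrementLaw S d t e :=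
  Finset.prod_pos fun _ _ => coordLaw_pos ht _

lemma sum_incrementLaw (t : ℝ) : ∑ e, incrementLaw S d t e = 1 := by
  have := Finset.prod_univ_sum (fun _ : Fin d => (Finset.univ : Finset (Fin S)))
    (fun _ c => coordLaw S t c)
  simpa [sum_coordLaw, incrementLaw] using this.symm

lemma incrementLaw_add_single (t : ℝ) (e : State S d) (i : Fin d) (c : Fin S) :
    incrementLaw S d t (e + Pi.single i c)
      = (∏ j ∈ Finset.univ.erase i, coordLaw S t (e j)) * coordLaw S t (e i + c) := by
  rw [incrementLaw, ← Finset.prod_erase_mul _ _ (Finset.mem_univ i)]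
  congr 1
  · refine Finset.prod_congr rfl fun j hj => ?_
    simp [Finset.ne_of_mem_erase hj]
  · simp

/-- Rate `1 / S` to every other value amounts to resampling each coordinate uniformly at rate 1,
independently of the others. The product law then solves the forward equation because each factor
satisfies κ' = 1/S - κ. -/
lemma transition_uniformRate (t : ℝ) (x y : State S d) :
    transition (uniformRate S d) t x y = incrementLaw S d t (y - x) := by
  have h := eq_transition_of_hasDerivAt (uniformRate S d)
    (fun t => Matrix.of fun x y => incrementLaw S d t (y - x)) ?_ ?_ t
  · rw [← h]; rfl
  · ext x y
    simp only [Matrix.of_apply, incrementLaw, coordLaw, neg_zero, Real.exp_zero, sub_self, zero_div,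
      add_zero, Matrix.one_apply, Finset.prod_ite_zero, Finset.prod_const_one]
    congr 1
    simp only [Finset.mem_univ, true_imp_iff, Pi.sub_apply, sub_eq_zero, eq_iff_iff]
    exact ⟨fun h => funext fun i => (h i).symm, fun h i => by rw [h]⟩
  · intro t x y
    simp only [Matrix.of_apply, Matrix.mul_apply]
    rw [sum_mul_uniformRate (fun z => incrementLaw S d t (z - x))]
    refine (HasDerivAt.fun_finsetProd (u := Finset.univ)
      (fun i (_ : i ∈ Finset.univ) =>
        hasDerivAt_coordLaw (S := S) t ((y - x) i))).congr_deriv ?_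
    symm
    rw [Finset.mul_sum]
    refine Finset.sum_congr rfl fun i _ => ?_
    have h1 : ∀ c, y + Pi.single i c - x = (y - x) + Pi.single i c := fun c => by abel
    have h2 : incrementLaw S d t (y - x)
        = (∏ j ∈ Finset.univ.erase i, coordLaw S t ((y - x) j)) * coordLaw S t ((y - x) i) := by
      simpa using incrementLaw_add_single t (y - x) i 0
    have h3 : ∑ c, coordLaw S t ((y - x) i + c) = 1 := by
      rw [← sum_coordLaw (S := S) t]
      exact Equiv.sum_comp (Equiv.addLeft ((y - x) i)) (coordLaw S t)
    simp only [h1, incrementLaw_add_single]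
    rw [h2, Finset.sum_sub_distrib, ← Finset.mul_sum, h3]
    have := natCast_pos_of_neZero (S := S)
    simp only [Finset.sum_const, Finset.card_univ, Fintype.card_fin, nsmul_eq_mul, smul_eq_mul]
    field_simp

lemma sum_incrementLaw_mul (s t : ℝ) (e : State S d) :
    ∑ y, incrementLaw S d s y * incrementLaw S d t (e - y) = incrementLaw S d (s + t) e := by
  have h := congrFun (congrFun (transition_add (uniformRate S d) s t) 0) e
  simpa [Matrix.mul_apply, transition_uniformRate] using h.symm

end

section

variable {S d : ℕ} [NeZero S]

/-! ### Marginals of the noising process -/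

lemma marginal_eq (q₀ : State S d → ℝ) (t : ℝ) (x : State S d) :
    marginal q₀ t x = ∑ y, q₀ y * incrementLaw S d t (x - y) := by
  simp [marginal, transition_uniformRate]

lemma marginal_add (q₀ : State S d → ℝ) (s t : ℝ) (x : State S d) :
    marginal q₀ (s + t) x = ∑ e, incrementLaw S d t e * marginal q₀ s (x + e) := by
  simp only [marginal_eq, Finset.mul_sum]
  rw [Finset.sum_comm]
  refine Finset.sum_congr rfl fun y _ => ?_
  rw [← sum_incrementLaw_mul, Finset.mul_sum]
  rw [← Equiv.sum_comp (Equiv.addLeft (x - y))]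
  refine Finset.sum_congr rfl fun e _ => ?_
  have h1 : x - y - ((Equiv.addLeft (x - y)) e) = -e := by simp
  have h2 : (Equiv.addLeft (x - y)) e = x + e - y := by simp; abel
  rw [h1, h2, incrementLaw_neg]
  ring

lemma marginal_add' (q₀ : State S d → ℝ) (s t : ℝ) (x : State S d) :
    marginal q₀ (s + t) x = ∑ y, marginal q₀ s y * incrementLaw S d t (x - y) := by
  rw [marginal_add, ← Equiv.sum_comp (Equiv.addLeft x) fun y =>
    marginal q₀ s y * incrementLaw S d t (x - y)]
  refine Finset.sum_congr rfl fun e _ => ?_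
  have h1 : x - (Equiv.addLeft x) e = -e := by simp
  rw [h1, incrementLaw_neg, mul_comm]
  rfl

lemma sum_marginal {q₀ : State S d → ℝ} (hq : q₀ ∈ stdSimplex ℝ (State S d)) (t : ℝ) :
    ∑ x, marginal q₀ t x = 1 := by
  simp only [marginal_eq]
  rw [Finset.sum_comm]
  have : ∀ y : State S d, ∑ x, incrementLaw S d t (x - y) = 1 := fun y => by
    rw [← sum_incrementLaw (S := S) (d := d) t]
    exact Equiv.sum_comp (Equiv.subRight y) (incrementLaw S d t)
  simp only [← Finset.mul_sum, this, mul_one]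
  exact hq.2

lemma marginal_nonneg {q₀ : State S d → ℝ} (hq : q₀ ∈ stdSimplex ℝ (State S d)) {t : ℝ}
    (ht : 0 ≤ t) (x : State S d) : 0 ≤ marginal q₀ t x := by
  rw [marginal_eq]
  exact Finset.sum_nonneg fun y _ => mul_nonneg (hq.1 y) (incrementLaw_nonneg ht _)

lemma marginal_pos {q₀ : State S d → ℝ} (hq : q₀ ∈ stdSimplex ℝ (State S d)) {t : ℝ}
    (ht : 0 < t) (x : State S d) : 0 < marginal q₀ t x := by
  rw [marginal_eq]
  obtain ⟨y, -, hy⟩ : ∃ y ∈ Finset.univ, 0 < q₀ y := by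
    by_contra! h
    have := Finset.sum_nonpos h
    rw [hq.2] at this
    linarith
  refine Finset.sum_pos' (fun y _ => mul_nonneg (hq.1 y) (incrementLaw_nonneg ht.le _))
    ⟨y, Finset.mem_univ y, mul_pos hy (incrementLaw_pos ht _)⟩

lemma hasDerivAt_marginal (q₀ : State S d → ℝ) (t : ℝ) (x : State S d) :
    HasDerivAt (fun t => marginal q₀ t x)
      (1 / (S : ℝ) * ∑ i, ∑ c : Fin S,
        (marginal q₀ t (x + Pi.single i c) - marginal q₀ t x)) t := by
  rw [← sum_mul_uniformRate (marginal q₀ t) x]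
  have h := HasDerivAt.fun_sum (u := Finset.univ) fun (y : State S d) _ =>
    (hasDerivAt_transition (uniformRate S d) y x t).const_mul (q₀ y)
  refine h.congr_deriv ?_
  simp only [Matrix.mul_apply, marginal, Finset.mul_sum, Finset.sum_mul]
  rw [Finset.sum_comm]
  exact Finset.sum_congr rfl fun _ _ => Finset.sum_congr rfl fun _ _ => by ring

lemma continuous_marginal (q₀ : State S d → ℝ) (x : State S d) :
    Continuous fun t => marginal q₀ t x :=
  continuous_iff_continuousAt.2 fun t => (hasDerivAt_marginal q₀ t x).continuousAt

/-! ### Relative entropy and Fisher information -/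

/-- The relative entropy of `q_t` with respect to the uniform distribution. -/
def relEntropy (q₀ : State S d → ℝ) (t : ℝ) : ℝ :=
  d * Real.log S - entropy (marginal q₀ t)

/-- The entropy production of the noising process at time `t`. -/
def fisherInfo (q₀ : State S d → ℝ) (t : ℝ) : ℝ :=
  1 / (S : ℝ) * ∑ i, ∑ c : Fin S, ∑ x, marginal q₀ t (x + Pi.single i c) *
    Real.log (marginal q₀ t (x + Pi.single i c) / marginal q₀ t x)

lemma relEntropy_nonneg {q₀ : State S d → ℝ} (hq : q₀ ∈ stdSimplex ℝ (State S d)) {t : ℝ}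
    (ht : 0 ≤ t) : 0 ≤ relEntropy q₀ t := by
  have hS := natCast_pos_of_neZero (S := S)
  have hpow : (0 : ℝ) < (S : ℝ) ^ d := by positivity
  -- Gibbs' inequality before summation: log y ≤ y - 1 at the ratio y of the uniform mass to `q_t
  -- x`.
  have key : ∀ x, Real.negMulLog (marginal q₀ t x)
      ≤ 1 / (S : ℝ) ^ d - marginal q₀ t x + marginal q₀ t x * (d * Real.log S) := by
    intro x
    rcases (marginal_nonneg hq ht x).eq_or_lt with h | h
    · rw [← h]; simp
    · have := Real.log_le_sub_one_of_pos (x := 1 / (S ^ d * marginal q₀ t x)) (by positivity)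
      rw [one_div, Real.log_inv, Real.log_mul hpow.ne' h.ne', Real.log_pow] at this
      have h2 := mul_le_mul_of_nonneg_left this h.le
      have h3 : marginal q₀ t x * ((S ^ d * marginal q₀ t x)⁻¹ - 1)
          = 1 / (S : ℝ) ^ d - marginal q₀ t x := by
        field_simp
      rw [h3] at h2
      rw [Real.negMulLog]
      linarith
  have := Finset.sum_le_sum fun x (_ : x ∈ Finset.univ) => key x
  rw [Finset.sum_add_distrib, Finset.sum_sub_distrib, ← Finset.sum_mul, sum_marginal hq] at this
  simp only [Finset.sum_const, Finset.card_univ, Fintype.card_fun, Fintype.card_fin,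
    nsmul_eq_mul, Nat.cast_pow] at this
  rw [mul_one_div_cancel hpow.ne'] at this
  simp only [relEntropy, entropy]
  linarith

lemma relEntropy_le {q₀ : State S d → ℝ} (hq : q₀ ∈ stdSimplex ℝ (State S d)) {t : ℝ}
    (ht : 0 ≤ t) : relEntropy q₀ t ≤ d * Real.log S := by
  have : 0 ≤ entropy (marginal q₀ t) := by
    refine Finset.sum_nonneg fun x _ => Real.negMulLog_nonneg (marginal_nonneg hq ht x) ?_
    rw [← sum_marginal hq t]
    exact Finset.single_le_sum (fun y _ => marginal_nonneg hq ht y) (Finset.mem_univ x)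
  simp only [relEntropy]
  linarith

lemma continuous_relEntropy (q₀ : State S d → ℝ) : Continuous (relEntropy q₀) := by
  unfold relEntropy entropy
  refine continuous_const.sub (continuous_finsetSum _ fun x _ => ?_)
  exact Real.continuous_negMulLog.comp (continuous_marginal q₀ x)

lemma sum_add_single {M : Type*} [AddCommMonoid M] (f : State S d → M) (y : State S d) :
    ∑ x, f (x + y) = ∑ x, f x :=
  Equiv.sum_comp (Equiv.addRight y) f

/-- Positive times are needed because `negMulLog` is not differentiable at 0. Translation invariance
of the sum over states regroups the derivative into relative entropies between `q_t` and its shifts.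
-/
lemma hasDerivAt_relEntropy {q₀ : State S d → ℝ} (hq : q₀ ∈ stdSimplex ℝ (State S d)) {t : ℝ}
    (ht : 0 < t) : HasDerivAt (relEntropy q₀) (-fisherInfo q₀ t) t := by
  have hpos := marginal_pos hq ht
  have h := (HasDerivAt.fun_sum (u := Finset.univ) fun (x : State S d) _ =>
    (Real.hasDerivAt_negMulLog (hpos x).ne').comp t (hasDerivAt_marginal q₀ t x)).const_sub
      (d * Real.log S)
  refine h.congr_deriv ?_
  rw [neg_inj, fisherInfo]
  simp only [mul_left_comm _ (1 / (S : ℝ)), ← Finset.mul_sum]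
  congr 1
  simp only [Finset.mul_sum]
  rw [Finset.sum_comm]
  refine Finset.sum_congr rfl fun i _ => ?_
  rw [Finset.sum_comm]
  refine Finset.sum_congr rfl fun c _ => ?_
  have e1 := sum_add_single (fun x => marginal q₀ t x * Real.log (marginal q₀ t x))
    (Pi.single i c)
  have e2 := sum_add_single (fun x => marginal q₀ t x) (Pi.single i c)
  have e3 : ∀ x, marginal q₀ t (x + Pi.single i c) *
      Real.log (marginal q₀ t (x + Pi.single i c) / marginal q₀ t x)
      = marginal q₀ t (x + Pi.single i c) * Real.log (marginal q₀ t (x + Pi.single i c))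
        - marginal q₀ t (x + Pi.single i c) * Real.log (marginal q₀ t x) := fun x => by
    rw [Real.log_div (hpos _).ne' (hpos _).ne']; ring
  have e4 : ∀ x, (-Real.log (marginal q₀ t x) - 1) *
      (marginal q₀ t (x + Pi.single i c) - marginal q₀ t x)
      = marginal q₀ t x * Real.log (marginal q₀ t x)
        - marginal q₀ t (x + Pi.single i c) * Real.log (marginal q₀ t x)
        - marginal q₀ t (x + Pi.single i c) + marginal q₀ t x := fun x => by ring
  simp only [e3, e4, Finset.sum_sub_distrib, Finset.sum_add_distrib, e1, e2]
  ring

/-! ### Exponential decay of the Fisher information -/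

/-- The function a log (a/b) is convex and homogeneous of degree one; the left side is its
supporting hyperplane at (A, B). -/
lemma mul_log_div_ge {a b A B : ℝ} (ha : 0 < a) (hb : 0 < b) (hA : 0 < A) (hB : 0 < B) :
    a * Real.log (A / B) + a - b * (A / B) ≤ a * Real.log (a / b) := by
  have h := Real.log_le_sub_one_of_pos (x := (b / a) * (A / B)) (by positivity)
  rw [Real.log_mul (by positivity) (by positivity), ← inv_div a b, Real.log_inv] at h
  have h2 := mul_le_mul_of_nonneg_left h ha.le
  have h3 : a * ((a / b)⁻¹ * (A / B) - 1) = b * (A / B) - a := by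
    field_simp
  rw [h3] at h2
  linarith

/-- The log-sum inequality. -/
lemma log_sum_le {ι : Type*} (s : Finset ι) (w a b : ι → ℝ) (hw : ∀ j ∈ s, 0 ≤ w j)
    (ha : ∀ j ∈ s, 0 < a j) (hb : ∀ j ∈ s, 0 < b j) (hA : 0 < ∑ j ∈ s, w j * a j)
    (hB : 0 < ∑ j ∈ s, w j * b j) :
    (∑ j ∈ s, w j * a j) * Real.log ((∑ j ∈ s, w j * a j) / ∑ j ∈ s, w j * b j)
      ≤ ∑ j ∈ s, w j * (a j * Real.log (a j / b j)) := by
  set A := ∑ j ∈ s, w j * a j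
  set B := ∑ j ∈ s, w j * b j
  have h : ∑ j ∈ s, w j * (a j * Real.log (A / B) + a j - b j * (A / B))
      ≤ ∑ j ∈ s, w j * (a j * Real.log (a j / b j)) :=
    Finset.sum_le_sum fun j hj =>
      mul_le_mul_of_nonneg_left (mul_log_div_ge (ha j hj) (hb j hj) hA hB) (hw j hj)
  have h2 : ∑ j ∈ s, w j * (a j * Real.log (A / B) + a j - b j * (A / B))
      = A * Real.log (A / B) + A - B * (A / B) := by
    simp only [A, B, Finset.sum_mul, ← Finset.sum_add_distrib, ← Finset.sum_sub_distrib]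
    exact Finset.sum_congr rfl fun _ _ => by ring
  rw [h2, mul_div_cancel₀ _ hB.ne'] at h
  linarith

/-- The log-sum inequality in which the common mass `B` contributes B log (B/B) = 0. Working with
supporting hyperplanes covers `B = 0` as well. -/
lemma log_sum_add_le {α F G B : ℝ} (hα : 0 < α) (hF : 0 < F) (hG : 0 < G) (hB : 0 ≤ B) :
    (α * F + B) * Real.log ((α * F + B) / (α * G + B)) ≤ α * (F * Real.log (F / G)) := by
  have hA : 0 < α * F + B := by positivity
  have hD : 0 < α * G + B := by positivity
  have h1 := mul_le_mul_of_nonneg_left (mul_log_div_ge hF hG hA hD) hα.le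
  have h2 : B * Real.log ((α * F + B) / (α * G + B)) + B
      - B * ((α * F + B) / (α * G + B)) ≤ 0 := by
    have := Real.log_le_sub_one_of_pos (div_pos hA hD)
    nlinarith
  have h3 : (α * G + B) * ((α * F + B) / (α * G + B)) = α * F + B :=
    mul_div_cancel₀ _ hD.ne'
  nlinarith

lemma relEntropy_shift_nonneg {f : State S d → ℝ} (hf : ∀ x, 0 < f x) (y : State S d) :
    0 ≤ ∑ x, f (x + y) * Real.log (f (x + y) / f x) := by
  have : ∑ x, (f (x + y) - f x) ≤ ∑ x, f (x + y) * Real.log (f (x + y) / f x) := by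
    refine Finset.sum_le_sum fun x _ => ?_
    have := mul_log_div_ge (hf (x + y)) (hf x) one_pos one_pos
    simpa using this
  rw [Finset.sum_sub_distrib, sum_add_single, sub_self] at this
  exact this

lemma fisherInfo_nonneg {q₀ : State S d → ℝ} (hq : q₀ ∈ stdSimplex ℝ (State S d)) {t : ℝ}
    (ht : 0 < t) : 0 ≤ fisherInfo q₀ t := by
  unfold fisherInfo
  exact mul_nonneg (by positivity) (Finset.sum_nonneg fun i _ => Finset.sum_nonneg fun c _ =>
    relEntropy_shift_nonneg (marginal_pos hq ht) _)

/-- The summand is the product law of the noise with coordinate `i` frozen, hence has total mass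
one. -/
lemma sum_prod_erase_ite (s : ℝ) (i : Fin d) :
    ∑ e : State S d, (if e i = 0 then ∏ j ∈ Finset.univ.erase i, coordLaw S s (e j) else 0)
      = 1 := by
  have h := Finset.prod_univ_sum (fun _ : Fin d => (Finset.univ : Finset (Fin S)))
    (fun j c => if j = i then (if c = 0 then 1 else 0) else coordLaw S s c)
  have h1 : ∀ j : Fin d, ∑ c : Fin S,
      (if j = i then (if c = 0 then 1 else 0) else coordLaw S s c) = 1 := fun j => by
    by_cases hj : j = i
    · simp [hj]
    · simp [hj, sum_coordLaw]
  rw [Finset.prod_congr rfl fun j _ => h1 j, Finset.prod_const_one, Fintype.piFinset_univ] at h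
  rw [h]
  refine Finset.sum_congr rfl fun e _ => ?_
  rw [← Finset.mul_prod_erase _ _ (Finset.mem_univ i)]
  have h2 : ∏ j ∈ Finset.univ.erase i,
      (if j = i then (if e j = 0 then 1 else 0) else coordLaw S s (e j))
      = ∏ j ∈ Finset.univ.erase i, coordLaw S s (e j) :=
    Finset.prod_congr rfl fun j hj => if_neg (Finset.ne_of_mem_erase hj)
  rw [h2]
  simp

/-- Strong data processing for the relative entropy between a function and its shift. -/
lemma relEntropy_shift_noise_le {f g : State S d → ℝ} (hq' : ∀ x, 0 < f x) {s : ℝ} (hs : 0 < s)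
    (hg : ∀ x, g x = ∑ e, incrementLaw S d s e * f (x + e)) (i : Fin d) (c : Fin S) :
    ∑ x, g (x + Pi.single i c) * Real.log (g (x + Pi.single i c) / g x)
      ≤ Real.exp (-s) * ∑ x, f (x + Pi.single i c) *
          Real.log (f (x + Pi.single i c) / f x) := by
  let r : State S d → ℝ := fun e => ∏ j ∈ Finset.univ.erase i, coordLaw S s (e j)
  let w : State S d → ℝ := fun e => if e i = 0 then r e else 0
  have hr : ∀ e, 0 < r e := fun e => Finset.prod_pos fun j _ => coordLaw_pos hs _
  have hw : ∀ e, 0 ≤ w e := fun e => by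
    simp only [w]; split_ifs; exacts [(hr e).le, le_rfl]
  have hw0 : 0 < w 0 := by simpa [w] using hr 0
  -- Coordinate `i` is either kept, with weight `exp (-s)`, or resampled uniformly; `w` and `r`
  -- describe the noise of the other coordinates in these two cases.
  have hsplit : ∀ e, incrementLaw S d s e
      = Real.exp (-s) * w e + (1 - Real.exp (-s)) / S * r e := fun e => by
    have := incrementLaw_add_single s e i 0
    simp only [Pi.single_zero, add_zero] at this
    rw [this]
    simp only [w, r, coordLaw]
    split_ifs <;> ring
  let F : State S d → ℝ := fun x => ∑ e, w e * f (x + e)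
  let B : State S d → ℝ := fun x => (1 - Real.exp (-s)) / S * ∑ e, r e * f (x + e)
  have hFdef : ∀ x, F x = ∑ e, w e * f (x + e) := fun _ => rfl
  have hF : ∀ x, 0 < F x := fun x => by
    rw [hFdef]
    refine Finset.sum_pos' (fun e _ => mul_nonneg (hw e) (hq' _).le)
      ⟨0, Finset.mem_univ _, mul_pos hw0 (hq' _)⟩
  have hB : ∀ x, 0 ≤ B x := fun x => by
    have : Real.exp (-s) < 1 := by simpa using hs
    exact mul_nonneg (div_nonneg (by linarith) (by positivity))
      (Finset.sum_nonneg fun e _ => mul_nonneg (hr e).le (hq' _).le)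
  -- A resampled coordinate has forgotten its shift. `B` is thus common to `g` and its translate,
  -- and `log_sum_add_le` removes it, leaving the factor `exp (-s)`.
  have hBshift : ∀ x, B (x + Pi.single i c) = B x := fun x => by
    simp only [B]
    congr 1
    rw [← sum_add_single (fun e => r e * f (x + e)) (Pi.single i c)]
    refine Finset.sum_congr rfl fun e _ => ?_
    have h1 : r (e + Pi.single i c) = r e := Finset.prod_congr rfl fun j hj => by
      simp [Finset.ne_of_mem_erase hj]
    rw [h1, add_right_comm, ← add_assoc]
  have hm : ∀ x, g x = Real.exp (-s) * F x + B x := fun x => by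
    rw [hg]
    simp only [hsplit, F, B, Finset.mul_sum, ← Finset.sum_add_distrib]
    exact Finset.sum_congr rfl fun e _ => by ring
  calc ∑ x, g (x + Pi.single i c) *
        Real.log (g (x + Pi.single i c) / g x)
      ≤ ∑ x, Real.exp (-s) *
          (F (x + Pi.single i c) * Real.log (F (x + Pi.single i c) / F x)) := by
        refine Finset.sum_le_sum fun x _ => ?_
        rw [hm, hm, hBshift]
        exact log_sum_add_le (Real.exp_pos _) (hF _) (hF _) (hB _)
    _ ≤ ∑ x, Real.exp (-s) * ∑ e, w e * (f (x + Pi.single i c + e) *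
          Real.log (f (x + Pi.single i c + e) / f (x + e))) := by
        refine Finset.sum_le_sum fun x _ =>
          mul_le_mul_of_nonneg_left ?_ (Real.exp_pos _).le
        have h := log_sum_le Finset.univ w (fun e => f (x + Pi.single i c + e))
          (fun e => f (x + e)) (fun e _ => hw e) (fun e _ => hq' _) (fun e _ => hq' _)
        rw [← hFdef, ← hFdef] at h
        exact h (hF _) (hF _)
    _ = Real.exp (-s) * ((∑ e, w e) * ∑ x, f (x + Pi.single i c) *
          Real.log (f (x + Pi.single i c) / f x)) := by
        rw [← Finset.mul_sum, Finset.sum_comm, Finset.sum_mul]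
        congr 1
        refine Finset.sum_congr rfl fun e _ => ?_
        rw [← Finset.mul_sum]
        congr 1
        have h := sum_add_single (fun x => f (x + Pi.single i c) *
          Real.log (f (x + Pi.single i c) / f x)) e
        rw [← h]
        exact Finset.sum_congr rfl fun x _ => by rw [add_right_comm]
    _ = Real.exp (-s) * ∑ x, f (x + Pi.single i c) *
          Real.log (f (x + Pi.single i c) / f x) := by
        rw [show ∑ e, w e = 1 from sum_prod_erase_ite s i, one_mul]

lemma fisherInfo_add_le {q₀ : State S d → ℝ} (hq : q₀ ∈ stdSimplex ℝ (State S d)) {t s : ℝ}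
    (ht : 0 < t) (hs : 0 < s) :
    fisherInfo q₀ (t + s) ≤ Real.exp (-s) * fisherInfo q₀ t := by
  unfold fisherInfo
  rw [mul_left_comm]
  refine mul_le_mul_of_nonneg_left ?_ (by positivity)
  rw [Finset.mul_sum]
  refine Finset.sum_le_sum fun i _ => ?_
  rw [Finset.mul_sum]
  exact Finset.sum_le_sum fun c _ =>
    relEntropy_shift_noise_le (marginal_pos hq ht) hs (marginal_add q₀ t s) i c

end

section

variable {S d : ℕ} [NeZero S]

/-! ### From the Riemann-sum gap to the number of steps -/

/-- Going back by `s` from level `a + h` multiplies the Fisher information by at least e^s ≥ 1 + s;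
integrating 1 + s over [0, h] gives the factor. The linear part is the Riemann-sum term, the
quadratic part the loss of one step. -/
lemma relEntropy_sub_ge {q₀ : State S d → ℝ} (hq : q₀ ∈ stdSimplex ℝ (State S d)) {a h : ℝ}
    (ha : 0 ≤ a) (hh : 0 < h) :
    (h + h ^ 2 / 2) * fisherInfo q₀ (a + h) ≤ relEntropy q₀ a - relEntropy q₀ (a + h) := by
  let φ : ℝ → ℝ := fun s => relEntropy q₀ (a + h - s) - (s + s ^ 2 / 2) * fisherInfo q₀ (a + h)
  have hφ : MonotoneOn φ (Set.Icc 0 h) := by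
    refine monotoneOn_of_hasDerivWithinAt_nonneg (convex_Icc 0 h)
      (f' := fun s => fisherInfo q₀ (a + h - s) - (1 + s) * fisherInfo q₀ (a + h)) ?_ ?_ ?_
    · have := continuous_relEntropy q₀
      exact Continuous.continuousOn (by fun_prop)
    · intro s hs
      rw [interior_Icc] at hs
      refine HasDerivAt.hasDerivWithinAt ?_
      have h1 := (hasDerivAt_relEntropy hq (t := a + h - s) (by linarith [hs.2])).comp s
        ((hasDerivAt_id s).const_sub (a + h))
      have h2 := (((hasDerivAt_id s).add ((hasDerivAt_pow 2 s).div_const 2)).mul_const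
        (fisherInfo q₀ (a + h)))
      refine (h1.sub h2).congr_deriv ?_
      simp
    · intro s hs
      rw [interior_Icc] at hs
      have hb : 0 < a + h - s := by linarith [hs.2]
      have h1 := fisherInfo_add_le hq hb hs.1
      rw [sub_add_cancel] at h1
      have h2 := mul_le_mul_of_nonneg_left h1 (Real.exp_pos s).le
      rw [← mul_assoc, ← Real.exp_add, add_neg_cancel, Real.exp_zero, one_mul] at h2
      have h3 := mul_le_mul_of_nonneg_right (Real.add_one_le_exp s)
        (fisherInfo_nonneg hq (t := a + h) (by linarith))
      linarith
  have := hφ (Set.left_mem_Icc.2 hh.le) (Set.right_mem_Icc.2 hh.le) hh.le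
  simp only [φ, add_sub_cancel_right, sub_zero] at this
  linarith

lemma relEntropy_antitone {q₀ : State S d → ℝ} (hq : q₀ ∈ stdSimplex ℝ (State S d)) {a b : ℝ}
    (ha : 0 ≤ a) (hab : a ≤ b) : relEntropy q₀ b ≤ relEntropy q₀ a := by
  rcases hab.eq_or_lt with rfl | h
  · rfl
  · have h1 := relEntropy_sub_ge hq ha (sub_pos.2 h)
    rw [add_sub_cancel] at h1
    have h2 := fisherInfo_nonneg hq (t := b) (by linarith)
    have h3 : 0 ≤ (b - a + (b - a) ^ 2 / 2) * fisherInfo q₀ b := by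
      have := sub_pos.2 h
      positivity
    linarith

/-- Between levels 0 and `t` at least t I(t) of entropy is spent, out of at most d log S available.
-/
lemma fisherInfo_le {q₀ : State S d → ℝ} (hq : q₀ ∈ stdSimplex ℝ (State S d)) {t : ℝ}
    (ht : 1 ≤ t) : fisherInfo q₀ t ≤ d * Real.log S := by
  have h1 := relEntropy_sub_ge hq le_rfl (zero_lt_one.trans_le ht)
  rw [zero_add] at h1
  have h2 := relEntropy_le hq (le_refl 0)
  have h3 := relEntropy_nonneg hq (zero_le_one.trans ht)
  have h4 := fisherInfo_nonneg hq (zero_lt_one.trans_le ht)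
  nlinarith [mul_nonneg (sub_nonneg.2 ht) h4, mul_nonneg (sq_nonneg t) h4]

/-- Each step has gap g ≥ h² I / 2, and the gaps sum to at most `C`. Since h I ≤ μ h² I / 2 + I /
(2μ), few steps would leave the entropy spent above level 1 unaccounted for. -/
lemma card_steps_ge {q₀ : State S d → ℝ} (hq : q₀ ∈ stdSimplex ℝ (State S d)) {γ C : ℝ}
    (hγ : 0 < γ) (hC : 0 ≤ C) (h1 : γ * (d * Real.log S) ≤ relEntropy q₀ 1)
    {N : ℕ} (hN : 0 < N) (u : ℕ → ℝ) (hu : ∀ k < N, u (k + 1) < u k) (huN : 0 ≤ u N)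
    (huN' : u N ≤ 1)
    (hgap : relEntropy q₀ (u N) - ∑ k ∈ Finset.range N, (u k - u (k + 1)) * fisherInfo q₀ (u k)
      ≤ C) :
    γ * min 1 γ / (4 * (C + 1)) * (d * Real.log S) ≤ N := by
  set L := (d : ℝ) * Real.log S with hL
  have hL0 : 0 ≤ L := mul_nonneg (by positivity) (Real.log_natCast_nonneg S)
  have hN1 : (1 : ℝ) ≤ N := by exact_mod_cast hN
  have hanti : ∀ k ≤ N, 0 ≤ u k := by
    intro k hk
    induction hk using Nat.decreasingInduction with
    | self => exact huN
    | of_succ k hk ih => exact ih.trans (hu k hk).le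
  -- If γL is this small, the claimed bound is at most 1; the factor `min 1 γ` in place of `γ`
  -- serves this case.
  rcases le_or_gt (γ * L) (4 * (C + 1)) with hsmall | hbig
  · refine le_trans ?_ hN1
    rw [div_mul_eq_mul_div, div_le_one (by positivity)]
    calc γ * min 1 γ * L = min 1 γ * (γ * L) := by ring
      _ ≤ 1 * (γ * L) := mul_le_mul_of_nonneg_right (min_le_left _ _) (by positivity)
      _ ≤ _ := by linarith
  -- With this weight μC ≤ γL/4, while C ≤ γL/4 by `hbig`; half of γL is left to be paid by the term
  -- N L / (2μ).
  · set μ := γ * L / (4 * (C + 1)) with hμ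
    have hμ1 : 1 < μ := by rwa [hμ, one_lt_div (by positivity)]
    -- Truncating levels at 1 keeps only the entropy spent where I ≤ L. Steps starting at or below
    -- level 1 contribute zero on the left.
    have hstep : ∀ k ∈ Finset.range N,
        relEntropy q₀ (max (u (k + 1)) 1) - relEntropy q₀ (max (u k) 1)
          ≤ (1 + μ) * (relEntropy q₀ (u (k + 1)) - relEntropy q₀ (u k)
            - (u k - u (k + 1)) * fisherInfo q₀ (u k)) + L / (2 * μ) := by
      intro k hk
      rw [Finset.mem_range] at hk
      have hk1 := hanti (k + 1) hk
      have hh : 0 < u k - u (k + 1) := sub_pos.2 (hu k hk)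
      have hg := relEntropy_sub_ge hq hk1 hh
      rw [add_sub_cancel] at hg
      have hF := fisherInfo_nonneg hq (t := u k) (by linarith)
      set h := u k - u (k + 1)
      set g := relEntropy q₀ (u (k + 1)) - relEntropy q₀ (u k) - h * fisherInfo q₀ (u k)
        with hgdef
      have hg' : h ^ 2 / 2 * fisherInfo q₀ (u k) ≤ g := by rw [hgdef]; linarith
      have hg0 : 0 ≤ g := le_trans (by positivity) hg'
      rcases le_or_gt (u k) 1 with hle | hgt
      · rw [max_eq_right hle, max_eq_right ((hu k hk).le.trans hle), sub_self]
        positivity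
      · have hFL := fisherInfo_le hq hgt.le
        have hK : relEntropy q₀ (max (u (k + 1)) 1) ≤ relEntropy q₀ (u (k + 1)) :=
          relEntropy_antitone hq hk1 (le_max_left _ _)
        rw [max_eq_left hgt.le]
        have ham : h * fisherInfo q₀ (u k) ≤ μ * g + L / (2 * μ) := by
          have e1 : h ≤ μ * (h ^ 2 / 2) + 1 / (2 * μ) := by
            have : μ * (h ^ 2 / 2) + 1 / (2 * μ) - h = (μ * h - 1) ^ 2 / (2 * μ) := by
              field_simp; ring
            have h0 : 0 ≤ (μ * h - 1) ^ 2 / (2 * μ) := by positivity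
            linarith
          calc h * fisherInfo q₀ (u k)
              ≤ (μ * (h ^ 2 / 2) + 1 / (2 * μ)) * fisherInfo q₀ (u k) :=
                mul_le_mul_of_nonneg_right e1 hF
            _ = μ * (h ^ 2 / 2 * fisherInfo q₀ (u k)) + fisherInfo q₀ (u k) / (2 * μ) := by ring
            _ ≤ μ * g + L / (2 * μ) := by gcongr
        rw [hgdef] at ham ⊢
        linarith
    have hsum := Finset.sum_le_sum hstep
    rw [Finset.sum_range_sub (fun k => relEntropy q₀ (max (u k) 1)), Finset.sum_add_distrib,
      ← Finset.mul_sum, Finset.sum_sub_distrib, Finset.sum_range_sub (fun k => relEntropy q₀ (u k)),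
      Finset.sum_const, Finset.card_range, nsmul_eq_mul, max_eq_right huN'] at hsum
    have hK0 : relEntropy q₀ (max (u 0) 1) ≤ relEntropy q₀ (u 0) :=
      relEntropy_antitone hq (hanti 0 (Nat.zero_le _)) (le_max_left _ _)
    have hK0' := relEntropy_nonneg hq (hanti 0 (Nat.zero_le _))
    set X := relEntropy q₀ (u N) - relEntropy q₀ (u 0)
      - ∑ k ∈ Finset.range N, (u k - u (k + 1)) * fisherInfo q₀ (u k) with hX
    have hXC : X ≤ C - relEntropy q₀ (u 0) := by rw [hX]; linarith
    have hmul : (1 + μ) * X ≤ (1 + μ) * (C - relEntropy q₀ (u 0)) :=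
      mul_le_mul_of_nonneg_left hXC (by linarith)
    -- The entropy remaining at the starting level enters with coefficient 1 - (1 + μ) ≤ 0 and can
    -- be dropped.
    have hmul2 : 0 ≤ μ * relEntropy q₀ (u 0) := by positivity
    have hmain : γ * L ≤ C + μ * C + N * (L / (2 * μ)) := by linarith
    have hμC : μ * C ≤ γ * L / 4 := by
      rw [hμ, div_mul_eq_mul_div, div_le_div_iff₀ (by positivity) (by positivity)]
      have : 0 ≤ γ * L := by positivity
      nlinarith
    have hLμ : L / (2 * μ) = 2 * (C + 1) / γ := by
      have : L ≠ 0 := by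
        rintro h0
        rw [h0, mul_zero] at hbig
        linarith
      rw [hμ]
      field_simp
      ring
    rw [hLμ] at hmain
    have h5 : γ * L / 2 ≤ N * (2 * (C + 1) / γ) := by linarith
    have h6 : γ * L / 2 * γ ≤ N * (2 * (C + 1)) := by
      have := mul_le_mul_of_nonneg_right h5 hγ.le
      rwa [mul_assoc (N : ℝ), div_mul_cancel₀ _ hγ.ne'] at this
    rw [div_mul_eq_mul_div, div_le_iff₀ (by positivity)]
    calc γ * min 1 γ * L ≤ γ * γ * L := by gcongr; exact min_le_right _ _
      _ ≤ N * (4 * (C + 1)) := by linarith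

end

section

variable {S d : ℕ} [NeZero S]

/-! ### The score entropy loss -/

/-- The score entropy loss as a real number. -/
def realScoreLoss (q₀ : State S d → ℝ) (t : ℝ) (sh : State S d → State S d → ℝ≥0) : ℝ :=
  ∑ z, ∑ i, ∑ c ∈ Finset.univ.erase (0 : Fin S), 1 / (S : ℝ) *
    (marginal q₀ t z * sh (z + Pi.single i c) z - marginal q₀ t (z + Pi.single i c)
      - marginal q₀ t (z + Pi.single i c) * (Real.log (sh (z + Pi.single i c) z)
        - Real.log (marginal q₀ t (z + Pi.single i c) / marginal q₀ t z)))

lemma scoreEntropyLoss_eq (q₀ : State S d → ℝ) (t : ℝ) (sh : State S d → State S d → ℝ≥0) :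
    scoreEntropyLoss q₀ t sh = ∑ z, ∑ i, ∑ c ∈ Finset.univ.erase (0 : Fin S),
      ENNReal.ofReal (marginal q₀ t z) *
        (ENNReal.ofReal (1 / (S : ℝ) * score q₀ t (z + Pi.single i c) z) *
          bregman (sh (z + Pi.single i c) z) (score q₀ t (z + Pi.single i c) z)) := by
  unfold scoreEntropyLoss
  refine Finset.sum_congr rfl fun z _ => ?_
  simp only [← Finset.mul_sum]
  congr 1
  rw [← sum_neighbors z fun y => ENNReal.ofReal (1 / (S : ℝ) * score q₀ t y z) *
    bregman (sh y z) (score q₀ t y z), Finset.sum_filter]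
  refine Eq.trans ?_ (Finset.sum_subset (Finset.erase_subset z Finset.univ) ?_)
  · refine Finset.sum_congr rfl fun y hy => ?_
    rw [uniformRate_of_ne (Finset.ne_of_mem_erase hy)]
    split_ifs <;> simp
  · intro y _ hy
    have : y = z := by simpa using hy
    simp [this]

lemma score_pos {q₀ : State S d → ℝ} (hq : q₀ ∈ stdSimplex ℝ (State S d)) {t : ℝ}
    (ht : 0 < t) (y x : State S d) : 0 < score q₀ t y x :=
  div_pos (marginal_pos hq ht y) (marginal_pos hq ht x)

/-- At a positive level every state has positive mass, so a single zero estimate, for which the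
Bregman divergence is infinite, would make the whole loss infinite. -/
lemma estimate_pos_of_scoreEntropyLoss_ne_top {q₀ : State S d → ℝ}
    (hq : q₀ ∈ stdSimplex ℝ (State S d)) {t : ℝ} (ht : 0 < t)
    {sh : State S d → State S d → ℝ≥0} (h : scoreEntropyLoss q₀ t sh ≠ ⊤) (z : State S d)
    (i : Fin d) {c : Fin S} (hc : c ≠ 0) : (0 : ℝ) < sh (z + Pi.single i c) z := by
  rw [scoreEntropyLoss_eq] at h
  have h1 := ENNReal.sum_ne_top.1 h z (Finset.mem_univ z)
  have h2 := ENNReal.sum_ne_top.1 h1 i (Finset.mem_univ i)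
  have h3 := ENNReal.sum_ne_top.1 h2 c (by simpa using hc)
  have hS := natCast_pos_of_neZero (S := S)
  by_contra hneg
  apply h3
  rw [bregman, if_neg fun h => hneg h.1, ENNReal.mul_top, ENNReal.mul_top]
  · simpa using marginal_pos hq ht z
  · have := score_pos hq ht (z + Pi.single i c) z
    simp only [ne_eq, ENNReal.ofReal_eq_zero, not_le]
    positivity

lemma scoreEntropyLoss_eq_ofReal {q₀ : State S d → ℝ}
    (hq : q₀ ∈ stdSimplex ℝ (State S d)) {t : ℝ} (ht : 0 < t)
    {sh : State S d → State S d → ℝ≥0}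
    (hsh : ∀ z (i : Fin d) (c : Fin S), c ≠ 0 → (0 : ℝ) < sh (z + Pi.single i c) z) :
    scoreEntropyLoss q₀ t sh = ENNReal.ofReal (realScoreLoss q₀ t sh) ∧
      0 ≤ realScoreLoss q₀ t sh := by
  have hS := natCast_pos_of_neZero (S := S)
  have hterm : ∀ z (i : Fin d) (c : Fin S), c ≠ 0 →
      1 / (S : ℝ) *
        (marginal q₀ t z * sh (z + Pi.single i c) z - marginal q₀ t (z + Pi.single i c)
        - marginal q₀ t (z + Pi.single i c) * (Real.log (sh (z + Pi.single i c) z)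
        - Real.log (marginal q₀ t (z + Pi.single i c) / marginal q₀ t z)))
      = marginal q₀ t z * (1 / (S : ℝ) * score q₀ t (z + Pi.single i c) z *
          (sh (z + Pi.single i c) z / score q₀ t (z + Pi.single i c) z - 1
            - Real.log (sh (z + Pi.single i c) z / score q₀ t (z + Pi.single i c) z))) := by
    intro z i c hc
    have h1 := hsh z i c hc
    have h2 := score_pos hq ht (z + Pi.single i c) z
    have h3 := marginal_pos hq ht z
    rw [Real.log_div h1.ne' h2.ne']
    have h4 : marginal q₀ t (z + Pi.single i c)
        = marginal q₀ t z * score q₀ t (z + Pi.single i c) z := by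
      rw [score, mul_div_cancel₀ _ h3.ne']
    have h5 : marginal q₀ t (z + Pi.single i c) / marginal q₀ t z
        = score q₀ t (z + Pi.single i c) z := rfl
    rw [h5, h4]
    field_simp
  have hD : ∀ x : ℝ, 0 < x → 0 ≤ x - 1 - Real.log x := fun x hx => by
    have := Real.log_le_sub_one_of_pos hx
    linarith
  have hnn : ∀ z (i : Fin d) (c : Fin S), c ≠ 0 → 0 ≤
      marginal q₀ t z * (1 / (S : ℝ) * score q₀ t (z + Pi.single i c) z *
          (sh (z + Pi.single i c) z / score q₀ t (z + Pi.single i c) z - 1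
            - Real.log (sh (z + Pi.single i c) z / score q₀ t (z + Pi.single i c) z))) := by
    intro z i c hc
    have h2 := score_pos hq ht (z + Pi.single i c) z
    have h3 := marginal_pos hq ht z
    have := hD _ (div_pos (hsh z i c hc) h2)
    positivity
  have hreal : realScoreLoss q₀ t sh = ∑ z, ∑ i, ∑ c ∈ Finset.univ.erase (0 : Fin S),
      marginal q₀ t z * (1 / (S : ℝ) * score q₀ t (z + Pi.single i c) z *
          (sh (z + Pi.single i c) z / score q₀ t (z + Pi.single i c) z - 1
            - Real.log (sh (z + Pi.single i c) z / score q₀ t (z + Pi.single i c) z))) :=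
    Finset.sum_congr rfl fun z _ => Finset.sum_congr rfl fun i _ => Finset.sum_congr rfl
      fun c hc => hterm z i c (Finset.ne_of_mem_erase hc)
  have hnn1 := fun z (i : Fin d) (c : Fin S) (hc : c ∈ Finset.univ.erase (0 : Fin S)) =>
    hnn z i c (Finset.ne_of_mem_erase hc)
  have hnn2 := fun z (i : Fin d) => Finset.sum_nonneg (hnn1 z i)
  have hnn3 := fun z => Finset.sum_nonneg fun (i : Fin d) (_ : i ∈ Finset.univ) => hnn2 z i
  refine ⟨?_, hreal ▸ Finset.sum_nonneg fun z _ => hnn3 z⟩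
  rw [scoreEntropyLoss_eq, hreal, ENNReal.ofReal_sum_of_nonneg fun z _ => hnn3 z]
  refine Finset.sum_congr rfl fun z _ => ?_
  rw [ENNReal.ofReal_sum_of_nonneg fun i _ => hnn2 z i]
  refine Finset.sum_congr rfl fun i _ => ?_
  rw [ENNReal.ofReal_sum_of_nonneg (hnn1 z i)]
  refine Finset.sum_congr rfl fun c hc => ?_
  have h2 := score_pos hq ht (z + Pi.single i c) z
  rw [bregman, if_pos ⟨hsh z i c (Finset.ne_of_mem_erase hc), h2⟩,
    ENNReal.ofReal_mul (marginal_pos hq ht z).le]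
  congr 1
  exact (ENNReal.ofReal_mul (by positivity)).symm

/-! ### The transition probabilities of a leap -/

lemma leapRate_add (sh : State S d → State S d → ℝ≥0) (z : State S d) (i : Fin d)
    (e a b : Fin S) : leapRate sh z i (a + e) (b + e) = leapRate sh z i a b := by
  unfold leapRate rateMatrix
  by_cases h : a = b
  · subst h
    simp only [if_true, neg_inj]
    refine (Finset.sum_bij (fun c _ => c + e) ?_ ?_ ?_ ?_).symm
    · intro c hc
      simpa using hc
    · intro c _ c' _ hcc
      exact add_right_cancel hcc
    · intro c hc
      exact ⟨c - e, by simpa [sub_eq_iff_eq_add] using hc, by simp⟩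
    · intro c _
      rw [add_sub_add_right_eq_sub]
  · rw [if_neg h, if_neg (by simpa using h)]
    simp only [add_sub_add_right_eq_sub]

/-- The law of the increment of coordinate `i` after time `η` of a leap started from `z`. -/
def leapLaw (sh : State S d → State S d → ℝ≥0) (z : State S d) (i : Fin d) (η : ℝ)
    (c : Fin S) : ℝ :=
  transition (leapRate sh z i) η 0 c

lemma transition_leapRate (sh : State S d → State S d → ℝ≥0) (z : State S d) (i : Fin d)
    (η : ℝ) (a b : Fin S) :
    transition (leapRate sh z i) η a b = leapLaw sh z i η (b - a) := by
  have := transition_equiv (leapRate sh z i) (Equiv.addRight a)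
    (fun x y => leapRate_add sh z i a x y) η 0 (b - a)
  simpa [leapLaw] using this

lemma leapRate_zero_of_ne (sh : State S d → State S d → ℝ≥0) (z : State S d) (i : Fin d)
    {c : Fin S} (hc : c ≠ 0) :
    leapRate sh z i 0 c = 1 / (S : ℝ) * sh (z + Pi.single i c) z := by
  simp only [leapRate, rateMatrix, if_neg hc.symm, sub_zero, shift_eq]

lemma leapRate_zero_zero (sh : State S d → State S d → ℝ≥0) (z : State S d) (i : Fin d) :
    leapRate sh z i 0 0
      = -∑ c ∈ Finset.univ.erase (0 : Fin S), 1 / (S : ℝ) * sh (z + Pi.single i c) z := by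
  simp only [leapRate, rateMatrix, if_true, sub_zero, shift_eq]

lemma tendsto_div_nhdsGT_of_hasDerivAt {f : ℝ → ℝ} {f' : ℝ} (h : HasDerivAt f f' 0) (h0 : f 0 = 0) :
    Tendsto (fun η => f η / η) (𝓝[>] 0) (𝓝 f') := by
  have := h.tendsto_slope_zero_right
  simp only [zero_add, h0, sub_zero, smul_eq_mul] at this
  exact this.congr fun η => by rw [div_eq_inv_mul]

variable {sh : State S d → State S d → ℝ≥0}

lemma hasDerivAt_leapLaw (z : State S d) (i : Fin d) (c : Fin S) :
    HasDerivAt (fun η => leapLaw sh z i η c) (leapRate sh z i 0 c) 0 :=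
  hasDerivAt_transition_zero _ _ _

lemma leapLaw_zero (z : State S d) (i : Fin d) (c : Fin S) :
    leapLaw sh z i 0 c = if c = 0 then 1 else 0 := by
  simp [leapLaw, transition_zero, Matrix.one_apply, eq_comm]

lemma coordLaw_zero (c : Fin S) : coordLaw S 0 c = if c = 0 then 1 else 0 := by
  simp [coordLaw]

lemma tendsto_leapLaw_div {z : State S d} {i : Fin d} {c : Fin S} (hc : c ≠ 0) :
    Tendsto (fun η => leapLaw sh z i η c / η) (𝓝[>] 0)
      (𝓝 (1 / (S : ℝ) * sh (z + Pi.single i c) z)) := by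
  rw [← leapRate_zero_of_ne sh z i hc]
  exact tendsto_div_nhdsGT_of_hasDerivAt (hasDerivAt_leapLaw z i c) (by simp [leapLaw_zero, hc])

/-- Short times suffice: staying put has probability near 1, and a jump has probability asymptotic
to its positive rate times `η`. -/
lemma eventually_leapLaw_pos
    (hsh : ∀ z (i : Fin d) (c : Fin S), c ≠ 0 → (0 : ℝ) < sh (z + Pi.single i c) z) :
    ∀ᶠ η in 𝓝[>] (0 : ℝ), ∀ z i c, 0 < leapLaw sh z i η c := by
  simp only [eventually_all]
  intro z i c
  by_cases hc : c = 0
  · subst hc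
    have h := (hasDerivAt_leapLaw (sh := sh) z i 0).continuousAt.tendsto
    rw [leapLaw_zero, if_pos rfl] at h
    exact (h.mono_left nhdsWithin_le_nhds).eventually_const_lt one_pos
  · have hS := natCast_pos_of_neZero (S := S)
    have h1 := hsh z i c hc
    have h := (tendsto_leapLaw_div (sh := sh) (z := z) (i := i) hc).eventually_const_lt
      (u := 0) (by positivity)
    filter_upwards [h, self_mem_nhdsWithin] with η hη hη0
    exact (div_pos_iff_of_pos_right hη0).1 hη

/-- Without a jump, the log-ratio grows at the difference of the two exit rates. -/
lemma tendsto_log_ratio_div (z : State S d) (i : Fin d) :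
    Tendsto (fun η => Real.log (coordLaw S η 0 / leapLaw sh z i η 0) / η) (𝓝[>] 0)
      (𝓝 (∑ c ∈ Finset.univ.erase (0 : Fin S), 1 / (S : ℝ) * (sh (z + Pi.single i c) z - 1))) := by
  have hκ : coordLaw S 0 (0 : Fin S) = 1 := by simp [coordLaw_zero]
  have hW : leapLaw sh z i 0 (0 : Fin S) = 1 := by simp [leapLaw_zero]
  have h := ((hasDerivAt_coordLaw (S := S) 0 0).div (hasDerivAt_leapLaw (sh := sh) z i 0)
    (by simp [hW])).log (by simp [hκ, hW])
  have hS := natCast_pos_of_neZero (S := S)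
  refine tendsto_div_nhdsGT_of_hasDerivAt (h.congr_deriv ?_) (by simp [hκ, hW])
  simp only [Pi.div_apply, hκ, hW, leapRate_zero_zero, mul_sub, Finset.sum_sub_distrib,
    Finset.sum_const, Finset.card_erase_of_mem (Finset.mem_univ (0 : Fin S)), Finset.card_univ,
    Fintype.card_fin, nsmul_eq_mul]
  rw [Nat.cast_sub (NeZero.one_le)]
  field_simp
  push_cast
  ring

/-- For `c ≠ 0` both probabilities are of order `η`, so their ratio tends to the ratio of the jump
rates. -/
lemma tendsto_log_ratio
    (hsh : ∀ z (i : Fin d) (c : Fin S), c ≠ 0 → (0 : ℝ) < sh (z + Pi.single i c) z)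
    (z : State S d) (i : Fin d) (c : Fin S) :
    Tendsto (fun η => Real.log (coordLaw S η c / leapLaw sh z i η c)) (𝓝[>] 0)
      (𝓝 (if c = 0 then 0 else -Real.log (sh (z + Pi.single i c) z))) := by
  split_ifs with hc
  · subst hc
    have h1 := (hasDerivAt_coordLaw (S := S) 0 0).continuousAt.tendsto
    have h2 := (hasDerivAt_leapLaw (sh := sh) z i 0).continuousAt.tendsto
    rw [leapLaw_zero, if_pos rfl] at h2
    rw [coordLaw_zero, if_pos rfl] at h1
    have := (h1.div h2 one_ne_zero).log (by norm_num)
    simpa using this.mono_left nhdsWithin_le_nhds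
  · have hS := natCast_pos_of_neZero (S := S)
    have h0 := hsh z i c hc
    have h1 : Tendsto (fun η => coordLaw S η c / η) (𝓝[>] 0) (𝓝 (1 / (S : ℝ))) := by
      refine tendsto_div_nhdsGT_of_hasDerivAt ((hasDerivAt_coordLaw (S := S) 0 c).congr_deriv ?_) ?_
      · simp [coordLaw_zero, hc]
      · simp [coordLaw_zero, hc]
    have h2 := tendsto_leapLaw_div (sh := sh) (z := z) (i := i) hc
    have h3 := (h1.div h2 (by positivity)).log (by positivity)
    have h4 : Real.log (1 / (S : ℝ) / (1 / (S : ℝ) * sh (z + Pi.single i c) z))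
        = -Real.log (sh (z + Pi.single i c) z) := by
      rw [← Real.log_inv]
      congr 1
      field_simp
    rw [h4] at h3
    refine h3.congr' ?_
    filter_upwards [self_mem_nhdsWithin] with η hη
    have : η ≠ 0 := (Set.mem_Ioi.1 hη).ne'
    simp only [Pi.div_apply]
    rw [div_div_div_cancel_right₀ this]

/-- The expected log-likelihood ratio gained by the noising process against a leap over a time
span `η`, started at noise level `u`. -/
def leapGain (q₀ : State S d → ℝ) (u : ℝ) (sh : State S d → State S d → ℝ≥0) (η : ℝ) : ℝ :=
  ∑ z, ∑ e, incrementLaw S d η e * marginal q₀ (u - η) (z + e) *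
    ∑ i, Real.log (coordLaw S η (e i) / leapLaw sh z i η (e i))

lemma incrementLaw_zero (e : State S d) : incrementLaw S d 0 e = if e = 0 then 1 else 0 := by
  have := transition_uniformRate (S := S) (d := d) 0 0 e
  rw [transition_zero, Matrix.one_apply, sub_zero] at this
  rw [← this]
  simp [eq_comm]

/-- To first order in `η`, no jump contributes the difference of exit rates, one jump contributes
its rate times the limiting log-ratio, and several jumps contribute nothing since `uniformRate`
vanishes there. -/
lemma tendsto_leapGain_div_aux (q₀ : State S d → ℝ) {u : ℝ}
    (hsh : ∀ z (i : Fin d) (c : Fin S), c ≠ 0 → (0 : ℝ) < sh (z + Pi.single i c) z) :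
    Tendsto (fun η => leapGain q₀ u sh η / η) (𝓝[>] 0)
      (𝓝 (∑ z, ∑ i, ∑ c ∈ Finset.univ.erase (0 : Fin S), 1 / (S : ℝ) *
        (marginal q₀ u z * (sh (z + Pi.single i c) z - 1)
          - marginal q₀ u (z + Pi.single i c) * Real.log (sh (z + Pi.single i c) z)))) := by
  simp only [leapGain, Finset.sum_div]
  refine tendsto_finsetSum _ fun z _ => ?_
  have hq : ∀ e : State S d, Tendsto (fun η => marginal q₀ (u - η) (z + e)) (𝓝[>] 0)
      (𝓝 (marginal q₀ u (z + e))) := fun e => by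
    have := ((continuous_marginal q₀ (z + e)).comp (continuous_sub_left u)).tendsto 0
    simp only [Function.comp_def, sub_zero] at this
    exact this.mono_left nhdsWithin_le_nhds
  have hA : ∀ e : State S d, HasDerivAt (fun η => incrementLaw S d η e)
      (uniformRate S d 0 e) 0 := fun e => by
    have := hasDerivAt_transition_zero (uniformRate S d) 0 e
    simpa only [transition_uniformRate, sub_zero] using this
  have h0 : Tendsto (fun η => incrementLaw S d η 0 * marginal q₀ (u - η) (z + 0) *
      (∑ i, Real.log (coordLaw S η ((0 : State S d) i) / leapLaw sh z i η ((0 : State S d) i))) / η)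
      (𝓝[>] 0) (𝓝 (1 * marginal q₀ u (z + 0) * ∑ i, ∑ c ∈ Finset.univ.erase (0 : Fin S),
        1 / (S : ℝ) * (sh (z + Pi.single i c) z - 1))) := by
    have h1 := (hA 0).continuousAt.tendsto.mono_left (nhdsWithin_le_nhds (s := Set.Ioi 0))
    rw [incrementLaw_zero, if_pos rfl] at h1
    have h2 := tendsto_finsetSum Finset.univ fun (i : Fin d) _ =>
      tendsto_log_ratio_div (sh := sh) z i
    refine ((h1.mul (hq 0)).mul h2).congr fun η => ?_
    rw [mul_div_assoc, Finset.sum_div]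
    rfl
  have he : ∀ e : State S d, e ≠ 0 → Tendsto (fun η => incrementLaw S d η e *
      marginal q₀ (u - η) (z + e) *
      (∑ i, Real.log (coordLaw S η (e i) / leapLaw sh z i η (e i))) / η)
      (𝓝[>] 0) (𝓝 (uniformRate S d 0 e * marginal q₀ u (z + e) *
        ∑ i, if e i = 0 then 0 else -Real.log (sh (z + Pi.single i (e i)) z))) := by
    intro e he
    have h1 := tendsto_div_nhdsGT_of_hasDerivAt (hA e) (by simp [incrementLaw_zero, he])
    have h2 := tendsto_finsetSum Finset.univ fun (i : Fin d) _ =>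
      tendsto_log_ratio hsh z i (e i)
    exact ((h1.mul (hq e)).mul h2).congr fun η => by ring
  have hsum : ∀ F : State S d → ℝ, ∑ e ∈ Finset.univ.erase 0, uniformRate S d 0 e * F e
      = ∑ i, ∑ c ∈ Finset.univ.erase (0 : Fin S), 1 / (S : ℝ) * F (Pi.single i c) := by
    intro F
    have h := sum_neighbors (0 : State S d) fun e => 1 / (S : ℝ) * F e
    simp only [zero_add] at h
    rw [← h, Finset.sum_filter]
    refine Eq.trans ?_ (Finset.sum_subset (Finset.erase_subset 0 Finset.univ) ?_)
    · refine Finset.sum_congr rfl fun y hy => ?_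
      rw [uniformRate_of_ne (Finset.ne_of_mem_erase hy).symm, hammingDist_comm]
      split_ifs <;> simp
    · intro y _ hy
      have : y = 0 := by simpa using hy
      simp [this]
  have hsplit := h0.add (tendsto_finsetSum (Finset.univ.erase (0 : State S d)) fun e hmem =>
    he e (Finset.ne_of_mem_erase hmem))
  simp only [mul_assoc (uniformRate S d 0 _)] at hsplit
  rw [hsum] at hsplit
  have hval : ∀ (i : Fin d), ∀ c ∈ Finset.univ.erase (0 : Fin S),
      (∑ j, if (Pi.single i c : State S d) j = 0 then 0
        else -Real.log (sh (z + Pi.single j ((Pi.single i c : State S d) j)) z))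
      = -Real.log (sh (z + Pi.single i c) z) := by
    intro i c hc
    rw [Finset.sum_eq_single i]
    · simp [Finset.ne_of_mem_erase hc]
    · intro j _ hj
      simp [hj]
    · simp
  have hlim : ∑ i, ∑ c ∈ Finset.univ.erase (0 : Fin S), 1 / (S : ℝ) *
        (marginal q₀ u z * (sh (z + Pi.single i c) z - 1)
          - marginal q₀ u (z + Pi.single i c) * Real.log (sh (z + Pi.single i c) z))
      = 1 * marginal q₀ u (z + 0) * ∑ i, ∑ c ∈ Finset.univ.erase (0 : Fin S),
          1 / (S : ℝ) * (sh (z + Pi.single i c) z - 1)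
        + ∑ i, ∑ c ∈ Finset.univ.erase (0 : Fin S), 1 / (S : ℝ) *
          (marginal q₀ u (z + Pi.single i c) *
            ∑ j, if (Pi.single i c : State S d) j = 0 then 0
              else -Real.log (sh (z + Pi.single j ((Pi.single i c : State S d) j)) z)) := by
    rw [one_mul, add_zero, Finset.mul_sum, ← Finset.sum_add_distrib]
    refine Finset.sum_congr rfl fun i _ => ?_
    rw [Finset.mul_sum, ← Finset.sum_add_distrib]
    refine Finset.sum_congr rfl fun c hc => ?_
    rw [hval i c hc]
    ring
  rw [hlim]
  exact hsplit.congr fun η => Finset.add_sum_erase Finset.univ _ (Finset.mem_univ (0 : State S d))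

lemma fisherInfo_eq_sum_erase (q₀ : State S d → ℝ) (u : ℝ) :
    fisherInfo q₀ u = ∑ i, ∑ c ∈ Finset.univ.erase (0 : Fin S), 1 / (S : ℝ) *
      ∑ x, marginal q₀ u (x + Pi.single i c) *
        Real.log (marginal q₀ u (x + Pi.single i c) / marginal q₀ u x) := by
  rw [fisherInfo, Finset.mul_sum]
  refine Finset.sum_congr rfl fun i _ => ?_
  rw [Finset.mul_sum]
  refine (Finset.sum_subset (Finset.erase_subset _ _) fun c _ hc => ?_).symm
  have hc0 : c = 0 := by simpa using hc
  refine mul_eq_zero_of_right _ (Finset.sum_eq_zero fun x _ => ?_)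
  have hx : x + Pi.single i c = x := by simp [hc0]
  rw [hx]
  rcases eq_or_ne (marginal q₀ u x) 0 with h | h <;> simp [h]

/-- The estimate-free part of the score loss is the Fisher information once the terms q(z) - q(z +
c), of total sum zero, are added; subtracting it leaves the limit found above. -/
lemma tendsto_leapGain_div {q₀ : State S d → ℝ} {u : ℝ}
    (hsh : ∀ z (i : Fin d) (c : Fin S), c ≠ 0 → (0 : ℝ) < sh (z + Pi.single i c) z) :
    Tendsto (fun η => leapGain q₀ u sh η / η) (𝓝[>] 0)
      (𝓝 (realScoreLoss q₀ u sh - fisherInfo q₀ u)) := by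
  have h := tendsto_leapGain_div_aux q₀ (u := u) hsh
  have heq : realScoreLoss q₀ u sh - fisherInfo q₀ u =
      ∑ z, ∑ i, ∑ c ∈ Finset.univ.erase (0 : Fin S), 1 / (S : ℝ) *
        (marginal q₀ u z * (sh (z + Pi.single i c) z - 1)
          - marginal q₀ u (z + Pi.single i c) * Real.log (sh (z + Pi.single i c) z)) := by
    have hF : fisherInfo q₀ u = ∑ z, ∑ i, ∑ c ∈ Finset.univ.erase (0 : Fin S), 1 / (S : ℝ) *
        (marginal q₀ u z - marginal q₀ u (z + Pi.single i c)
          + marginal q₀ u (z + Pi.single i c) *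
          Real.log (marginal q₀ u (z + Pi.single i c) / marginal q₀ u z)) := by
      rw [fisherInfo_eq_sum_erase]
      conv_rhs => rw [Finset.sum_comm]
      refine Finset.sum_congr rfl fun i _ => ?_
      conv_rhs => rw [Finset.sum_comm]
      refine Finset.sum_congr rfl fun c _ => ?_
      rw [← Finset.mul_sum, Finset.sum_add_distrib, Finset.sum_sub_distrib,
        sum_add_single (marginal q₀ u) (Pi.single i c), sub_self, zero_add]
    rw [hF, realScoreLoss]
    simp only [← Finset.sum_sub_distrib]
    exact Finset.sum_congr rfl fun z _ => Finset.sum_congr rfl fun i _ =>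
      Finset.sum_congr rfl fun c _ => by ring
  rw [heq]
  exact h

end

section

/-! ### Relative entropy on a finite space -/

lemma toReal_klDiv_of_fintype {A : Type*} [Fintype A] [MeasurableSpace A]
    [MeasurableSingletonClass A] (μ ν : Measure A) [IsProbabilityMeasure μ]
    [IsProbabilityMeasure ν] (hν : ∀ x, 0 < ν.real {x}) :
    (InformationTheory.klDiv μ ν).toReal
      = ∑ x, μ.real {x} * Real.log (μ.real {x} / ν.real {x}) := by
  have hac : μ ≪ ν := by
    intro s hs
    have : s = ∅ := by
      by_contra hne
      obtain ⟨x, hx⟩ := Set.nonempty_iff_ne_empty.2 hne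
      have h0 : ν {x} = 0 := measure_mono_null (by simpa using hx) hs
      have := hν x
      simp [Measure.real, h0] at this
    simp [this]
  have hd : ∀ x, (μ.rnDeriv ν x).toReal = μ.real {x} / ν.real {x} := by
    intro x
    have h := Measure.setLIntegral_rnDeriv hac {x}
    rw [lintegral_singleton] at h
    rw [Measure.real, Measure.real, ← h, ENNReal.toReal_mul, mul_div_assoc, div_self, mul_one]
    exact (hν x).ne'
  rw [InformationTheory.toReal_klDiv_eq_integral_klFun hac,
    integral_fintype (Integrable.of_finite)]
  have hsum : ∀ (ρ : Measure A) [IsProbabilityMeasure ρ], ∑ x, ρ.real {x} = 1 := by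
    intro ρ _
    rw [sum_measureReal_singleton]
    simp
  have : ∀ x, ν.real {x} • InformationTheory.klFun ((μ.rnDeriv ν x).toReal)
      = μ.real {x} * Real.log (μ.real {x} / ν.real {x}) + ν.real {x} - μ.real {x} := by
    intro x
    rw [hd, InformationTheory.klFun_apply, smul_eq_mul]
    have := (hν x).ne'
    field_simp
  simp only [this, Finset.sum_sub_distrib, Finset.sum_add_distrib, hsum]
  ring

lemma integral_comp_of_fintype {Ω A : Type*} [MeasurableSpace Ω] [Fintype A] [MeasurableSpace A]
    [DiscreteMeasurableSpace A] (μ : Measure Ω) [IsFiniteMeasure μ] {X : Ω → A}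
    (hX : Measurable X) (f : A → ℝ) :
    ∫ ω, f (X ω) ∂μ = ∑ a, μ.real (X ⁻¹' {a}) * f a := by
  have := Measure.isFiniteMeasure_map μ X
  rw [← integral_map hX.aemeasurable (Measurable.of_discrete.aestronglyMeasurable),
    integral_fintype Integrable.of_finite]
  refine Finset.sum_congr rfl fun a _ => ?_
  rw [map_measureReal_apply hX (MeasurableSet.singleton a), smul_eq_mul]

/-! ### Events determined by a path at finitely many times -/

section GridEvent

variable {α : Type*} {τ : ℝ}

/-- The paths which visit `x 0, …, x m` at the times `g 0, …, g m`. -/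
def gridEvent (g : ℕ → Set.Icc (0 : ℝ) τ) (x : ℕ → α) (m : ℕ) : Set (Path α τ) :=
  {ω | ∀ j ≤ m, ω.1 (g j) = x j}

lemma gridEvent_succ (g : ℕ → Set.Icc (0 : ℝ) τ) (x : ℕ → α) (m : ℕ) :
    gridEvent g x (m + 1)
      = gridEvent g x m ∩ {ω | ω.1 (g m) = x m} ∩ {ω | ω.1 (g (m + 1)) = x (m + 1)} := by
  ext ω
  simp only [gridEvent, Set.mem_ofPred_eq, Set.mem_inter_iff]
  constructor
  · exact fun h => ⟨⟨fun j hj => h j (by omega), h m (by omega)⟩, h (m + 1) le_rfl⟩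
  · rintro ⟨⟨h1, -⟩, h2⟩ j hj
    rcases Nat.le_succ_iff.1 hj with h | rfl
    · exact h1 j h
    · exact h2

lemma gridEvent_inter (g : ℕ → Set.Icc (0 : ℝ) τ) (x : ℕ → α) {j m : ℕ} (hj : j ≤ m) :
    gridEvent g x m ∩ {ω | ω.1 (g j) = x j} = gridEvent g x m :=
  Set.inter_eq_left.2 fun _ h => h j hj

variable [MeasurableSpace α]

lemma measurable_eval (r : Set.Icc (0 : ℝ) τ) : Measurable fun ω : Path α τ => ω.1 r :=
  (measurable_pi_apply r).comp measurable_subtype_coe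

variable [MeasurableSingletonClass α]

lemma measurableSet_eval (r : Set.Icc (0 : ℝ) τ) (a : α) :
    MeasurableSet {ω : Path α τ | ω.1 r = a} :=
  measurable_eval r (measurableSet_singleton a)

lemma measurableSet_history_eval {r s : Set.Icc (0 : ℝ) τ} (h : r ≤ s) (a : α) :
    MeasurableSet[history α τ s] {ω : Path α τ | ω.1 r = a} := by
  have hle : MeasurableSpace.comap (fun ω : Path α τ => ω.1 r) inferInstance ≤ history α τ s :=
    le_iSup (fun r : {r : Set.Icc (0 : ℝ) τ // r ≤ s} =>
      MeasurableSpace.comap (fun ω : Path α τ => ω.1 r.1) inferInstance) ⟨r, h⟩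
  exact hle _ ⟨{a}, measurableSet_singleton a, rfl⟩

lemma measurableSet_history_gridEvent {g : ℕ → Set.Icc (0 : ℝ) τ} (hg : Monotone g) (x : ℕ → α)
    (m : ℕ) : MeasurableSet[history α τ (g m)] (gridEvent g x m) := by
  have : gridEvent g x m = ⋂ j ∈ Finset.range (m + 1), {ω | ω.1 (g j) = x j} := by
    ext ω
    simp [gridEvent]
  rw [this]
  exact Finset.measurableSet_biInter _ fun j hj =>
    measurableSet_history_eval (hg (Nat.lt_succ_iff.1 (Finset.mem_range.1 hj))) _

omit [MeasurableSingletonClass α] in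
lemma measure_gridEvent (μ : Measure (Path α τ)) (g : ℕ → Set.Icc (0 : ℝ) τ) (x : ℕ → α)
    {w₀ : ℝ} (w : ℕ → ℝ) (n : ℕ) (hw : ∀ j < n, 0 ≤ w j)
    (h0 : μ {ω | ω.1 (g 0) = x 0} = ENNReal.ofReal w₀)
    (hstep : ∀ m < n, μ (gridEvent g x (m + 1)) = μ (gridEvent g x m) * ENNReal.ofReal (w m)) :
    μ (gridEvent g x n) = ENNReal.ofReal (w₀ * ∏ j ∈ Finset.range n, w j) := by
  induction n with
  | zero => simpa [gridEvent] using h0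
  | succ n ih =>
    rw [hstep n n.lt_succ_self, ih (fun j hj => hw j (hj.trans n.lt_succ_self))
      (fun m hm => hstep m (hm.trans n.lt_succ_self)), ← ENNReal.ofReal_mul' (hw n n.lt_succ_self),
      Finset.prod_range_succ, mul_assoc]

end GridEvent

/-! ### Finite-dimensional distributions -/

variable {S d : ℕ} [NeZero S]

section Noising

variable {T : ℝ} {q₀ : State S d → ℝ} {F : Measure (Path (State S d) T)}

lemma IsCTMC.measure_inter (hF : IsCTMC q₀ (uniformRate S d) F) {s u : Set.Icc (0 : ℝ) T}
    (hsu : s ≤ u) {H : Set (Path (State S d) T)} (hH : MeasurableSet[history (State S d) T s] H)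
    (a b : State S d) :
    F (H ∩ {ω | ω.1 s = a} ∩ {ω | ω.1 u = b})
      = F (H ∩ {ω | ω.1 s = a}) * ENNReal.ofReal (incrementLaw S d ((u : ℝ) - s) (b - a)) := by
  rw [hF.markov s u hsu H hH, transition_uniformRate]

lemma IsCTMC.measure_eval (hq : q₀ ∈ stdSimplex ℝ (State S d))
    (hF : IsCTMC q₀ (uniformRate S d) F) (hT : 0 ≤ T) (r : Set.Icc (0 : ℝ) T) (x : State S d) :
    F {ω | ω.1 r = x} = ENNReal.ofReal (marginal q₀ r x) := by
  let o : Set.Icc (0 : ℝ) T := ⟨0, le_rfl, hT⟩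
  have hor : o ≤ r := r.2.1
  have h1 : ∀ a, F ({ω | ω.1 o = a} ∩ {ω | ω.1 r = x})
      = ENNReal.ofReal (q₀ a * incrementLaw S d r (x - a)) := by
    intro a
    have := hF.measure_inter hor (H := Set.univ) MeasurableSet.univ a x
    simp only [Set.univ_inter] at this
    rw [this, hF.initial o rfl, ← ENNReal.ofReal_mul (hq.1 a)]
    simp [o]
  have h2 := sum_measure_preimage_singleton (μ := F.restrict {ω | ω.1 r = x})
    (f := fun ω : Path (State S d) T => ω.1 o) Finset.univ
    (fun y _ => measurableSet_eval o y)
  simp only [Finset.coe_univ, Set.preimage_univ, Measure.restrict_apply_univ] at h2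
  rw [← h2, marginal_eq, ENNReal.ofReal_sum_of_nonneg fun a _ =>
    mul_nonneg (hq.1 a) (incrementLaw_nonneg r.2.1 _)]
  refine Finset.sum_congr rfl fun a _ => ?_
  exact (Measure.restrict_apply (measurableSet_eval o a)).trans (h1 a)

lemma IsCTMC.measure_three (hq : q₀ ∈ stdSimplex ℝ (State S d))
    (hF : IsCTMC q₀ (uniformRate S d) F) (hT : 0 ≤ T) {r s u : Set.Icc (0 : ℝ) T} (hrs : r ≤ s)
    (hsu : s ≤ u) (b a z : State S d) :
    F ({ω | ω.1 r = b} ∩ {ω | ω.1 s = a} ∩ {ω | ω.1 u = z})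
      = ENNReal.ofReal (marginal q₀ r b * incrementLaw S d ((s : ℝ) - r) (a - b)
          * incrementLaw S d ((u : ℝ) - s) (z - a)) := by
  have h1 := hF.measure_inter hrs (H := Set.univ) MeasurableSet.univ b a
  simp only [Set.univ_inter] at h1
  rw [hF.measure_inter hsu (measurableSet_history_eval hrs b), h1, hF.measure_eval hq hT,
    ← ENNReal.ofReal_mul' (incrementLaw_nonneg (sub_nonneg.2 hrs) _),
    ← ENNReal.ofReal_mul' (incrementLaw_nonneg (sub_nonneg.2 hsu) _)]

lemma IsCTMC.measure_gridEvent (hq : q₀ ∈ stdSimplex ℝ (State S d))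
    (hF : IsCTMC q₀ (uniformRate S d) F) (hT : 0 ≤ T) {g : ℕ → Set.Icc (0 : ℝ) T}
    (hg : Monotone g) (x : ℕ → State S d) (n : ℕ) :
    F (gridEvent g x n) = ENNReal.ofReal (marginal q₀ (g 0) (x 0) *
      ∏ j ∈ Finset.range n, incrementLaw S d ((g (j + 1) : ℝ) - g j) (x (j + 1) - x j)) := by
  refine UniformDiffusion.measure_gridEvent F g x _ n
    (fun j _ => incrementLaw_nonneg (sub_nonneg.2 (hg j.le_succ)) _)
    (hF.measure_eval hq hT _ _) fun m _ => ?_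
  rw [gridEvent_succ, hF.measure_inter (hg m.le_succ) (measurableSet_history_gridEvent hg x m),
    gridEvent_inter g x le_rfl]

end Noising

/-- Grid step `j` lies inside leap `ℓ j`, and `κ j` is the grid index at which that leap begins,
where its rates are frozen. -/
lemma IsTauLeaping.measure_gridEvent {N : ℕ} {T τ : ℝ} {t : Fin (N + 1) → ℝ}
    {sh : ℝ → State S d → State S d → ℝ≥0} {P : Measure (Path (State S d) τ)}
    (hP : IsTauLeaping T t sh P) {g : ℕ → Set.Icc (0 : ℝ) τ} (hg : Monotone g)
    (hg0 : (g 0 : ℝ) = 0) (n : ℕ) (κ : ℕ → ℕ) (ℓ : ℕ → Fin N) (hκ : ∀ j < n, κ j ≤ j)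
    (hκt : ∀ j < n, (g (κ j) : ℝ) = t (ℓ j).castSucc)
    (hle : ∀ j < n, (g (j + 1) : ℝ) ≤ t (ℓ j).succ)
    (hpos : ∀ j < n, ∀ z i c,
      0 < leapLaw (sh (T - t (ℓ j).castSucc)) z i ((g (j + 1) : ℝ) - g j) c)
    (x : ℕ → State S d) :
    P (gridEvent g x n) = ENNReal.ofReal (1 / (S : ℝ) ^ d * ∏ j ∈ Finset.range n, ∏ i,
      leapLaw (sh (T - t (ℓ j).castSucc)) (x (κ j)) i ((g (j + 1) : ℝ) - g j)
        (x (j + 1) i - x j i)) := by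
  refine UniformDiffusion.measure_gridEvent P g x _ n
    (fun j hj => Finset.prod_nonneg fun i _ => (hpos j hj _ _ _).le) (hP.initial _ hg0 _)
    fun m hm => ?_
  have h := hP.leap (ℓ m) (g (κ m)) (g m) (g (m + 1)) (hκt m hm) (hg (hκ m hm)) (hg m.le_succ)
    (hle m hm) _ (measurableSet_history_gridEvent hg x m) (x (κ m)) (x m) (x (m + 1))
  rw [gridEvent_inter g x (hκ m hm), ← gridEvent_succ, gridEvent_inter g x le_rfl] at h
  simpa only [transition_leapRate] using h

section Reversal

variable {T τ : ℝ} {F : Measure (Path (State S d) T)} {Q : Measure (Path (State S d) τ)}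

omit [NeZero S] in
lemma IsTimeReversal.measure_eq (h : IsTimeReversal F Q) {n : ℕ} (u : Fin n → Set.Icc (0 : ℝ) τ)
    (v : Fin n → Set.Icc (0 : ℝ) T) (huv : ∀ j, (v j : ℝ) = T - (u j : ℝ))
    (x : Fin n → State S d) :
    Q {ω | ∀ j, ω.1 (u j) = x j} = F {ω | ∀ j, ω.1 (v j) = x j} := by
  have h1 := congrArg (fun μ => μ {x}) (h n u v huv)
  rw [Measure.map_apply (measurable_pi_lambda _ fun j => measurable_eval _)
      (measurableSet_singleton x),
    Measure.map_apply (measurable_pi_lambda _ fun j => measurable_eval _)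
      (measurableSet_singleton x)] at h1
  have e1 : {ω : Path (State S d) τ | ∀ j, ω.1 (u j) = x j}
      = (fun ω j => ω.1 (u j)) ⁻¹' {x} := by
    ext ω; simp [funext_iff]
  have e2 : {ω : Path (State S d) T | ∀ j, ω.1 (v j) = x j}
      = (fun ω j => ω.1 (v j)) ⁻¹' {x} := by
    ext ω; simp [funext_iff]
  rw [e1, e2, h1]

omit [NeZero S] in
lemma IsTimeReversal.isProbabilityMeasure [IsProbabilityMeasure F] (h : IsTimeReversal F Q) :
    IsProbabilityMeasure Q := by
  have := h.measure_eq (n := 0) Fin.elim0 Fin.elim0 (fun j => j.elim0) Fin.elim0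
  simp only [IsEmpty.forall_iff, Set.ofPred_true, measure_univ] at this
  exact ⟨this⟩

end Reversal

end

section

variable {S d : ℕ} [NeZero S]

/-! ### Lower bound on the path divergence along a grid -/

/-- The noise that separates the substep from the start of the leap is a convolution, so it commutes
with translation by `e`. Summing over the intermediate state `a` absorbs it into the marginal,
shifted by `e`. -/
lemma sum_backward_increment (q₀ : State S d → ℝ) (v η r : ℝ) (f : State S d → State S d → ℝ) :
    ∑ z, ∑ a, ∑ b, marginal q₀ v b * incrementLaw S d η (a - b) * incrementLaw S d r (z - a)
        * f (b - a) z
      = ∑ z, ∑ e, incrementLaw S d η e * marginal q₀ (v + r) (z + e) * f e z := by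
  refine Finset.sum_congr rfl fun z _ => ?_
  have h1 : ∀ a : State S d, ∑ b, marginal q₀ v b * incrementLaw S d η (a - b) *
      incrementLaw S d r (z - a) * f (b - a) z
      = ∑ e, marginal q₀ v (a + e) * incrementLaw S d η e *
        incrementLaw S d r (z - a) * f e z := fun a => by
    rw [← Equiv.sum_comp (Equiv.addLeft a) fun b => marginal q₀ v b * incrementLaw S d η (a - b) *
      incrementLaw S d r (z - a) * f (b - a) z]
    refine Finset.sum_congr rfl fun e _ => ?_
    simp only [Equiv.coe_addLeft, add_sub_cancel_left, sub_add_cancel_left, incrementLaw_neg]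
  simp only [h1]
  rw [Finset.sum_comm]
  refine Finset.sum_congr rfl fun e _ => ?_
  rw [marginal_add', ← sum_add_single
    (fun y => marginal q₀ v y * incrementLaw S d r (z + e - y)) e, Finset.mul_sum, Finset.sum_mul]
  refine Finset.sum_congr rfl fun a _ => ?_
  rw [add_sub_add_right_eq_sub]
  ring

section

variable {T τ : ℝ} {q₀ : State S d → ℝ} {F : Measure (Path (State S d) T)}
  {Q : Measure (Path (State S d) τ)}

/-- The point of `[0, T]` which corresponds to `r` under time reversal. -/
def reversedTime (hτ : τ ≤ T) (r : Set.Icc (0 : ℝ) τ) : Set.Icc (0 : ℝ) T :=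
  ⟨T - r, by linarith [r.2.2], by linarith [r.2.1]⟩

lemma integral_backward_increment (hq : q₀ ∈ stdSimplex ℝ (State S d))
    (hF : IsCTMC q₀ (uniformRate S d) F) (hQ : IsTimeReversal F Q) (hT : 0 ≤ T) (hτ : τ ≤ T)
    {r s u : Set.Icc (0 : ℝ) τ} (hrs : r ≤ s) (hsu : s ≤ u) (f : State S d → State S d → ℝ) :
    ∫ ω, f (ω.1 u - ω.1 s) (ω.1 r) ∂Q
      = ∑ z, ∑ e, incrementLaw S d ((u : ℝ) - s) e *
          marginal q₀ (T - r - ((u : ℝ) - s)) (z + e) * f e z := by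
  have := hF.isProbabilityMeasure
  have := hQ.isProbabilityMeasure
  have hX : Measurable fun ω : Path (State S d) τ => (ω.1 r, ω.1 s, ω.1 u) :=
    (measurable_eval r).prodMk ((measurable_eval s).prodMk (measurable_eval u))
  have hrs' : (r : ℝ) ≤ s := hrs
  have hsu' : (s : ℝ) ≤ u := hsu
  have hreal : ∀ z a b : State S d,
      Q.real ((fun ω : Path (State S d) τ => (ω.1 r, ω.1 s, ω.1 u)) ⁻¹' {(z, a, b)})
        = marginal q₀ (T - u) b * incrementLaw S d ((u : ℝ) - s) (a - b) *
          incrementLaw S d ((s : ℝ) - r) (z - a) := by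
    intro z a b
    have h1 := hQ.measure_eq ![r, s, u] ![reversedTime hτ r, reversedTime hτ s, reversedTime hτ u]
      (by intro j; fin_cases j <;> rfl) ![z, a, b]
    have h2 := hF.measure_three hq hT (r := reversedTime hτ u) (s := reversedTime hτ s)
      (u := reversedTime hτ r) (sub_le_sub_left hsu' T) (sub_le_sub_left hrs' T) b a z
    have e1 : (fun ω : Path (State S d) τ => (ω.1 r, ω.1 s, ω.1 u)) ⁻¹' {(z, a, b)}
        = {ω | ∀ j, ω.1 ((![r, s, u] : Fin 3 → _) j) = (![z, a, b] : Fin 3 → _) j} := by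
      ext ω; simp [Fin.forall_fin_succ]
    have e2 : {ω : Path (State S d) T | ∀ j, ω.1 ((![reversedTime hτ r, reversedTime hτ s,
          reversedTime hτ u] : Fin 3 → _) j) = (![z, a, b] : Fin 3 → _) j}
        = {ω | ω.1 (reversedTime hτ u) = b} ∩ {ω | ω.1 (reversedTime hτ s) = a} ∩
          {ω | ω.1 (reversedTime hτ r) = z} := by
      ext ω
      simp only [Fin.forall_fin_succ, Set.mem_ofPred_eq, Set.mem_inter_iff]
      simp
      tauto
    have hu : (0 : ℝ) ≤ T - u := by linarith [u.2.2]
    rw [Measure.real, e1, h1, e2, h2, ENNReal.toReal_ofReal]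
    · simp [reversedTime]
    · exact mul_nonneg (mul_nonneg (marginal_nonneg hq hu _)
        (incrementLaw_nonneg (by simp [reversedTime]; exact hsu) _))
        (incrementLaw_nonneg (by simp [reversedTime]; exact hrs) _)
  rw [integral_comp_of_fintype Q hX fun p => f (p.2.2 - p.2.1) p.1]
  simp only [Fintype.sum_prod_type, hreal]
  rw [sum_backward_increment]
  -- Only the length of the substep survives, not its position in the leap: equal substeps give
  -- equal contributions.
  have : T - (u : ℝ) + (s - r) = T - r - (u - s) := by ring
  rw [this]

lemma integral_terminal (hq : q₀ ∈ stdSimplex ℝ (State S d))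
    (hF : IsCTMC q₀ (uniformRate S d) F) (hQ : IsTimeReversal F Q) (hT : 0 ≤ T) (hτ : τ ≤ T)
    (r : Set.Icc (0 : ℝ) τ) (f : State S d → ℝ) :
    ∫ ω, f (ω.1 r) ∂Q = ∑ x, marginal q₀ (T - r) x * f x := by
  have := hF.isProbabilityMeasure
  have := hQ.isProbabilityMeasure
  rw [integral_comp_of_fintype Q (measurable_eval r) f]
  refine Finset.sum_congr rfl fun x _ => ?_
  have h1 := hQ.measure_eq (fun _ : Fin 1 => r) (fun _ => reversedTime hτ r) (fun _ => rfl)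
    (fun _ => x)
  simp only [forall_const] at h1
  have h2 := hF.measure_eval hq hT (reversedTime hτ r) x
  rw [h2] at h1
  have hr : (0 : ℝ) ≤ T - r := by linarith [r.2.2]
  have h3 : Q.real ((fun ω : Path (State S d) τ => ω.1 r) ⁻¹' {x}) = marginal q₀ (T - r) x := by
    rw [Measure.real]
    exact (congrArg ENNReal.toReal h1).trans (ENNReal.toReal_ofReal (marginal_nonneg hq hr x))
  rw [h3]

/-- The noising process starts from the last point of the reversed path. Reversal changes the sign
of the increments, and their law is even. -/
lemma IsTimeReversal.measure_gridEvent (hq : q₀ ∈ stdSimplex ℝ (State S d))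
    (hF : IsCTMC q₀ (uniformRate S d) F) (hQ : IsTimeReversal F Q) (hT : 0 ≤ T) (hτ : τ ≤ T)
    {g : ℕ → Set.Icc (0 : ℝ) τ} (hg : Monotone g) (x : ℕ → State S d) (n : ℕ) :
    Q (gridEvent g x n) = ENNReal.ofReal (marginal q₀ (T - g n) (x n) *
      ∏ j ∈ Finset.range n, incrementLaw S d ((g (j + 1) : ℝ) - g j) (x (j + 1) - x j)) := by
  have h1 := hQ.measure_eq (fun j : Fin (n + 1) => g j) (fun j => reversedTime hτ (g j))
    (fun _ => rfl) (fun j => x j)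
  have hmono : Monotone fun j => reversedTime hτ (g (n - j)) := fun i j hij =>
    sub_le_sub_left (show (g (n - j) : ℝ) ≤ g (n - i) from hg (by omega)) T
  have h2 := hF.measure_gridEvent hq hT hmono (fun j => x (n - j)) n
  have e1 : gridEvent g x n = {ω | ∀ j : Fin (n + 1), ω.1 (g j) = x j} := by
    ext ω
    exact ⟨fun h j => h j (Nat.lt_succ_iff.1 j.2), fun h j hj => h ⟨j, Nat.lt_succ_iff.2 hj⟩⟩
  have e2 : {ω : Path (State S d) T | ∀ j : Fin (n + 1), ω.1 (reversedTime hτ (g j)) = x j}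
      = gridEvent (fun j => reversedTime hτ (g (n - j))) (fun j => x (n - j)) n := by
    ext ω
    constructor
    · exact fun h j hj => h ⟨n - j, by omega⟩
    · intro h j
      have := h (n - j) (by omega)
      have hj : n - (n - (j : ℕ)) = j := by have := j.2; omega
      simpa only [hj] using this
  rw [e1, h1, e2, h2]
  congr 2
  rw [← Finset.prod_range_reflect]
  refine Finset.prod_congr rfl fun j hj => ?_
  rw [Finset.mem_range] at hj
  have hj1 : n - (n - 1 - j + 1) = j := by omega
  have hj2 : n - (n - 1 - j) = j + 1 := by omega
  rw [hj1, hj2, ← incrementLaw_neg, neg_sub]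
  congr 1
  simp [reversedTime]

/-- The divergence between the backward process and the sampler dominates the divergence between
their restrictions to a grid. -/
lemma relEntropy_add_sum_leapGain_le {N : ℕ} {t : Fin (N + 1) → ℝ}
    {sh : ℝ → State S d → State S d → ℝ≥0} {P : Measure (Path (State S d) τ)}
    (hq : q₀ ∈ stdSimplex ℝ (State S d)) (hF : IsCTMC q₀ (uniformRate S d) F)
    (hQ : IsTimeReversal F Q) (hP : IsTauLeaping T t sh P)
    (hkl : InformationTheory.klDiv Q P ≠ ⊤) (hT : 0 ≤ T) (hτ : τ ≤ T)
    {g : ℕ → Set.Icc (0 : ℝ) τ} (hg : Monotone g)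
    (hg0 : (g 0 : ℝ) = 0) (n : ℕ) (hgn : (g n : ℝ) = τ) (κ : ℕ → ℕ) (ℓ : ℕ → Fin N)
    (hlt : ∀ j < n, (g j : ℝ) < g (j + 1))
    (hκ : ∀ j < n, κ j ≤ j)
    (hκt : ∀ j < n, (g (κ j) : ℝ) = t (ℓ j).castSucc)
    (hle : ∀ j < n, (g (j + 1) : ℝ) ≤ t (ℓ j).succ)
    (hpos : ∀ j < n, ∀ z i c,
      0 < leapLaw (sh (T - t (ℓ j).castSucc)) z i ((g (j + 1) : ℝ) - g j) c) :
    relEntropy q₀ (T - τ) + ∑ j ∈ Finset.range n,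
        leapGain q₀ (T - t (ℓ j).castSucc) (sh (T - t (ℓ j).castSucc)) ((g (j + 1) : ℝ) - g j)
      ≤ (InformationTheory.klDiv Q P).toReal := by
  have := hF.isProbabilityMeasure
  have := hQ.isProbabilityMeasure
  have := hP.isProbabilityMeasure
  have hS := natCast_pos_of_neZero (S := S)
  let E : Path (State S d) τ → Fin (n + 1) → State S d := fun ω j => ω.1 (g j)
  have hE : Measurable E := measurable_pi_lambda _ fun j => measurable_eval _
  have := Measure.isProbabilityMeasure_map (μ := Q) hE.aemeasurable
  have := Measure.isProbabilityMeasure_map (μ := P) hE.aemeasurable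
  -- Values beyond `n` wrap around modulo `n + 1` and play no role.
  let ext : (Fin (n + 1) → State S d) → ℕ → State S d := fun x j => x (Fin.ofNat (n + 1) j)
  have hext : ∀ (x : Fin (n + 1) → State S d) (j : Fin (n + 1)), ext x j = x j := fun x j => by
    simp [ext]
  have hextE : ∀ ω j, j ≤ n → ext (E ω) j = ω.1 (g j) := fun ω j hj => by
    have : ((Fin.ofNat (n + 1) j : Fin (n + 1)) : ℕ) = j := by
      simp [Nat.mod_eq_of_lt (Nat.lt_succ_iff.2 hj)]
    simp only [ext, E, this]
  have hEev : ∀ x, E ⁻¹' {x} = gridEvent g (ext x) n := fun x => by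
    ext ω
    rw [Set.mem_preimage, Set.mem_singleton_iff, funext_iff]
    exact ⟨fun h j hj => (h ⟨j, Nat.lt_succ_iff.2 hj⟩).trans (hext x ⟨j, Nat.lt_succ_iff.2 hj⟩).symm,
      fun h j => (h j (Nat.lt_succ_iff.1 j.2)).trans (hext x j)⟩
  have hτ0 : 0 ≤ T - τ := by linarith
  have hQx : ∀ x, (Q.map E).real {x} = marginal q₀ (T - τ) (ext x n) *
      ∏ j ∈ Finset.range n,
        incrementLaw S d ((g (j + 1) : ℝ) - g j) (ext x (j + 1) - ext x j) := fun x => by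
    rw [map_measureReal_apply hE (MeasurableSet.singleton x), hEev, Measure.real,
      hQ.measure_gridEvent hq hF hT hτ hg, hgn, ENNReal.toReal_ofReal]
    exact mul_nonneg (marginal_nonneg hq hτ0 _) (Finset.prod_nonneg fun j _ =>
      incrementLaw_nonneg (sub_nonneg.2 (hg j.le_succ)) _)
  have hWpos : ∀ x : Fin (n + 1) → State S d, ∀ j ∈ Finset.range n, ∀ i : Fin d,
      0 < leapLaw (sh (T - t (ℓ j).castSucc)) (ext x (κ j)) i
        ((g (j + 1) : ℝ) - g j) (ext x (j + 1) i - ext x j i) :=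
    fun x j hj i => hpos j (Finset.mem_range.1 hj) _ _ _
  have hPx : ∀ x, (P.map E).real {x} = 1 / (S : ℝ) ^ d * ∏ j ∈ Finset.range n, ∏ i,
      leapLaw (sh (T - t (ℓ j).castSucc)) (ext x (κ j)) i ((g (j + 1) : ℝ) - g j)
        (ext x (j + 1) i - ext x j i) := fun x => by
    rw [map_measureReal_apply hE (MeasurableSet.singleton x), hEev, Measure.real,
      hP.measure_gridEvent hg hg0 n κ ℓ hκ hκt hle hpos, ENNReal.toReal_ofReal]
    exact mul_nonneg (by positivity) (Finset.prod_nonneg fun j hj =>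
      Finset.prod_nonneg fun i _ => (hWpos x j hj i).le)
  have hPpos : ∀ x, 0 < (P.map E).real {x} := fun x => by
    rw [hPx]
    exact mul_pos (by positivity) (Finset.prod_pos fun j hj =>
      Finset.prod_pos fun i _ => hWpos x j hj i)
  let G : ℕ → State S d → State S d → ℝ := fun j e z =>
    ∑ i, Real.log (coordLaw S ((g (j + 1) : ℝ) - g j) (e i) /
      leapLaw (sh (T - t (ℓ j).castSucc)) z i ((g (j + 1) : ℝ) - g j) (e i))
  -- The log-likelihood ratio is additive along the grid. The uniform initial law of the sampler
  -- supplies `d * log S`, which together with the terminal log-marginal averages to the relative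
  -- entropy.
  have hlog : ∀ x, (Q.map E).real {x} * Real.log ((Q.map E).real {x} / (P.map E).real {x})
      = (Q.map E).real {x} * (Real.log (marginal q₀ (T - τ) (ext x n)) + d * Real.log S
        + ∑ j ∈ Finset.range n, G j (ext x (j + 1) - ext x j) (ext x (κ j))) := by
    intro x
    -- The terminal level `T - τ` may be 0, where some states can have no mass.
    rcases eq_or_ne ((Q.map E).real {x}) 0 with h0 | h0
    · rw [h0, zero_mul, zero_mul]
    · congr 1
      have hm : marginal q₀ (T - τ) (ext x n) ≠ 0 := by
        intro hm
        rw [hQx, hm, zero_mul] at h0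
        exact h0 rfl
      have hκpos : ∀ j ∈ Finset.range n, ∀ i : Fin d,
          0 < coordLaw S ((g (j + 1) : ℝ) - g j) ((ext x (j + 1) - ext x j) i) :=
        fun j hj i => coordLaw_pos (sub_pos.2 (hlt j (Finset.mem_range.1 hj))) _
      rw [Real.log_div h0 (hPpos x).ne', hQx, hPx, Real.log_mul hm, Real.log_mul, Real.log_prod,
        Real.log_prod, one_div, Real.log_inv, Real.log_pow]
      · have : ∀ j ∈ Finset.range n, G j (ext x (j + 1) - ext x j) (ext x (κ j))
            = Real.log (incrementLaw S d ((g (j + 1) : ℝ) - g j) (ext x (j + 1) - ext x j))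
              - Real.log (∏ i, leapLaw (sh (T - t (ℓ j).castSucc)) (ext x (κ j)) i
                ((g (j + 1) : ℝ) - g j) (ext x (j + 1) i - ext x j i)) := by
          intro j hj
          rw [incrementLaw, Real.log_prod fun i _ => (hκpos j hj i).ne',
            Real.log_prod fun i _ => (hWpos x j hj i).ne', ← Finset.sum_sub_distrib]
          refine Finset.sum_congr rfl fun i _ => ?_
          rw [← Real.log_div (hκpos j hj i).ne' (hWpos x j hj i).ne']
          rfl
        rw [Finset.sum_congr rfl this, Finset.sum_sub_distrib]
        ring
      · exact fun j hj => (Finset.prod_pos fun i _ => hWpos x j hj i).ne'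
      · exact fun j hj => (incrementLaw_pos (sub_pos.2 (hlt j (Finset.mem_range.1 hj))) _).ne'
      · positivity
      · exact (Finset.prod_pos fun j hj => Finset.prod_pos fun i _ => hWpos x j hj i).ne'
      · exact (Finset.prod_pos fun j hj =>
          incrementLaw_pos (sub_pos.2 (hlt j (Finset.mem_range.1 hj))) _).ne'
  have hint : ∀ f : (Fin (n + 1) → State S d) → ℝ,
      ∑ x, (Q.map E).real {x} * f x = ∫ ω, f (E ω) ∂Q := fun f => by
    rw [integral_comp_of_fintype Q hE f]
    exact Finset.sum_congr rfl fun x _ => by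
      rw [map_measureReal_apply hE (MeasurableSet.singleton x)]
  have hone : ∑ x, (Q.map E).real {x} = 1 := by
    rw [sum_measureReal_singleton]
    simp
  have hfin : (InformationTheory.klDiv (Q.map E) (P.map E)).toReal
      = relEntropy q₀ (T - τ) + ∑ j ∈ Finset.range n,
        leapGain q₀ (T - t (ℓ j).castSucc) (sh (T - t (ℓ j).castSucc))
          ((g (j + 1) : ℝ) - g j) := by
    rw [toReal_klDiv_of_fintype _ _ hPpos, Finset.sum_congr rfl fun x _ => hlog x]
    simp only [mul_add, Finset.sum_add_distrib, Finset.mul_sum]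
    rw [Finset.sum_comm, ← Finset.sum_mul, hone, one_mul]
    congr 1
    · rw [hint fun x => Real.log (marginal q₀ (T - τ) (ext x n))]
      simp only [hextE _ n le_rfl]
      rw [integral_terminal hq hF hQ hT hτ (g n) fun y => Real.log (marginal q₀ (T - τ) y), hgn,
        relEntropy, entropy]
      simp only [Real.negMulLog, neg_mul, Finset.sum_neg_distrib]
      ring
    · refine Finset.sum_congr rfl fun j hj => ?_
      rw [Finset.mem_range] at hj
      rw [hint fun x => G j (ext x (j + 1) - ext x j) (ext x (κ j))]
      simp only [hextE _ (j + 1) hj, hextE _ j hj.le, hextE _ (κ j) ((hκ j hj).trans hj.le)]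
      rw [integral_backward_increment hq hF hQ hT hτ (hg (hκ j hj)) (hg j.le_succ) (G j),
        hκt j hj]
      rfl
  rw [← hfin]
  exact ENNReal.toReal_mono hkl (InformationTheory.klDiv_map_le Q P hE)

end

end

section

/-! ### Refining the schedule -/

/-- The subdivision of a sequence of times with `M` equal steps between consecutive times. -/
def refinedTime (a : ℕ → ℝ) (M j : ℕ) : ℝ :=
  a (j / M) + ((j % M : ℕ) : ℝ) / M * (a (j / M + 1) - a (j / M))

/-- The case `r = M`, where the quotient jumps, says that consecutive blocks match at their common
endpoint. -/
lemma refinedTime_mul_add (a : ℕ → ℝ) {M : ℕ} (hM : 0 < M) (q : ℕ) {r : ℕ} (hr : r ≤ M) :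
    refinedTime a M (M * q + r) = a q + (r : ℝ) / M * (a (q + 1) - a q) := by
  have hM' : (M : ℝ) ≠ 0 := by exact_mod_cast hM.ne'
  rcases hr.lt_or_eq with h | rfl
  · rw [refinedTime, Nat.mul_add_div hM, Nat.div_eq_of_lt h, Nat.mul_add_mod,
      Nat.mod_eq_of_lt h, add_zero]
  · have h1 : r * q + r = r * (q + 1) := by ring
    rw [refinedTime, h1, Nat.mul_div_cancel_left _ hM, Nat.mul_mod_right, div_self hM']
    simp

lemma refinedTime_mul (a : ℕ → ℝ) {M : ℕ} (hM : 0 < M) (q : ℕ) :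
    refinedTime a M (M * q) = a q := by
  simpa using refinedTime_mul_add a hM q (Nat.zero_le M)

lemma refinedTime_succ_sub (a : ℕ → ℝ) {M : ℕ} (hM : 0 < M) (j : ℕ) :
    refinedTime a M (j + 1) - refinedTime a M j = (a (j / M + 1) - a (j / M)) / M := by
  have h1 := refinedTime_mul_add a hM (j / M) (r := j % M + 1) (Nat.mod_lt j hM)
  rw [← add_assoc, Nat.div_add_mod] at h1
  rw [h1, refinedTime]
  push_cast
  ring

lemma refinedTime_succ_le {a : ℕ → ℝ} (ha : Monotone a) {M : ℕ} (hM : 0 < M) (j : ℕ) :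
    refinedTime a M (j + 1) ≤ a (j / M + 1) := by
  have h1 := refinedTime_mul_add a hM (j / M) (r := j % M + 1) (Nat.mod_lt j hM)
  rw [← add_assoc, Nat.div_add_mod] at h1
  rw [h1]
  have hM' : (0 : ℝ) < M := by exact_mod_cast hM
  have h2 : ((j % M + 1 : ℕ) : ℝ) / M ≤ 1 := by
    rw [div_le_one hM']
    exact_mod_cast Nat.mod_lt j hM
  have h3 : 0 ≤ a (j / M + 1) - a (j / M) := sub_nonneg.2 (ha (Nat.le_succ _))
  nlinarith

lemma monotone_refinedTime {a : ℕ → ℝ} (ha : Monotone a) {M : ℕ} (hM : 0 < M) :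
    Monotone (refinedTime a M) := by
  refine monotone_nat_of_le_succ fun j => ?_
  rw [← sub_nonneg, refinedTime_succ_sub a hM]
  exact div_nonneg (sub_nonneg.2 (ha (Nat.le_succ _))) (by positivity)

lemma sum_range_mul_comp_div (f : ℕ → ℝ) {M : ℕ} (hM : 0 < M) (N : ℕ) :
    ∑ j ∈ Finset.range (M * N), f (j / M) = ∑ k ∈ Finset.range N, (M : ℝ) * f k := by
  induction N with
  | zero => simp
  | succ N ih =>
    rw [Nat.mul_succ, Finset.sum_range_add, ih, Finset.sum_range_succ]
    congr 1
    rw [Finset.sum_congr rfl fun r hr => by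
      rw [Nat.mul_add_div hM, Nat.div_eq_of_lt (Finset.mem_range.1 hr), add_zero]]
    simp

/-- The schedule as a monotone sequence, constant after the last time. -/
def extendedSchedule {N : ℕ} (t : Fin (N + 1) → ℝ) (k : ℕ) : ℝ :=
  t ⟨min k N, by omega⟩

section

variable {N : ℕ} {t : Fin (N + 1) → ℝ}

lemma extendedSchedule_castSucc (k : Fin N) : extendedSchedule t k = t k.castSucc := by
  have : min (k : ℕ) N = k := min_eq_left k.2.le
  simp only [extendedSchedule, this]
  rfl

lemma extendedSchedule_succ (k : Fin N) : extendedSchedule t (k + 1) = t k.succ := by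
  have : min ((k : ℕ) + 1) N = k + 1 := min_eq_left k.2
  simp only [extendedSchedule, this]
  rfl

lemma extendedSchedule_zero : extendedSchedule t 0 = t 0 := by
  simp [extendedSchedule]

lemma extendedSchedule_last : extendedSchedule t N = t (Fin.last N) := by
  simp only [extendedSchedule, min_self]
  rfl

lemma monotone_extendedSchedule (ht : StrictMono t) : Monotone (extendedSchedule t) :=
  fun _ _ hij => ht.monotone (min_le_min_right N hij)

end

/-! ### The Riemann-sum gap -/

variable {S d : ℕ} [NeZero S]

lemma aggregatedLoss_eq_sum {N : ℕ} {t : Fin (N + 1) → ℝ} {T : ℝ} {q₀ : State S d → ℝ}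
    {sh : ℝ → State S d → State S d → ℝ≥0} {ε : ℝ≥0} (hq : q₀ ∈ stdSimplex ℝ (State S d))
    (ht : StrictMono t) (hu : ∀ k : Fin N, 0 < T - t k.castSucc)
    (hε : aggregatedLoss q₀ T t sh = ε) :
    (∀ k : Fin N, ∀ z (i : Fin d) (c : Fin S), c ≠ 0 →
      (0 : ℝ) < sh (T - t k.castSucc) (z + Pi.single i c) z) ∧
    ∑ k : Fin N, (t k.succ - t k.castSucc) *
      realScoreLoss q₀ (T - t k.castSucc) (sh (T - t k.castSucc)) = ε := by
  have hh : ∀ k : Fin N, 0 < t k.succ - t k.castSucc := fun k =>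
    sub_pos.2 (ht Fin.castSucc_lt_succ)
  have hne : ∀ k : Fin N, scoreEntropyLoss q₀ (T - t k.castSucc) (sh (T - t k.castSucc)) ≠ ⊤ := by
    intro k htop
    have h1 : aggregatedLoss q₀ T t sh ≠ ⊤ := hε ▸ ENNReal.coe_ne_top
    have h2 := ENNReal.sum_ne_top.1 h1 k (Finset.mem_univ k)
    rw [htop, ENNReal.mul_top (by simpa using hh k)] at h2
    exact h2 rfl
  have hpos : ∀ k : Fin N, ∀ z (i : Fin d) (c : Fin S), c ≠ 0 →
      (0 : ℝ) < sh (T - t k.castSucc) (z + Pi.single i c) z := fun k z i c hc =>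
    estimate_pos_of_scoreEntropyLoss_ne_top hq (hu k) (hne k) z i hc
  refine ⟨hpos, ?_⟩
  have hloss := fun k => scoreEntropyLoss_eq_ofReal hq (hu k) (hpos k)
  have h0 : ∀ k : Fin N, 0 ≤ (t k.succ - t k.castSucc) *
      realScoreLoss q₀ (T - t k.castSucc) (sh (T - t k.castSucc)) := fun k =>
    mul_nonneg (hh k).le (hloss k).2
  have h1 : aggregatedLoss q₀ T t sh = ENNReal.ofReal (∑ k : Fin N, (t k.succ - t k.castSucc) *
      realScoreLoss q₀ (T - t k.castSucc) (sh (T - t k.castSucc))) := by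
    rw [ENNReal.ofReal_sum_of_nonneg fun k _ => h0 k, aggregatedLoss]
    refine Finset.sum_congr rfl fun k _ => ?_
    rw [(hloss k).1, ENNReal.ofReal_mul (hh k).le]
  have h2 := congrArg ENNReal.toReal (h1.symm.trans hε)
  rwa [ENNReal.toReal_ofReal (Finset.sum_nonneg fun k _ => h0 k), ENNReal.coe_toReal] at h2

/-- Splitting each leap into `M` equal substeps gives `M` equal gains. As `M` grows, the divergence
on the grid tends to H(δ) plus the aggregated loss minus the Riemann sum, and the loss cancels
against the hypothesis. -/
lemma relEntropy_sub_sum_fisherInfo_le {N : ℕ} {t : Fin (N + 1) → ℝ} {T δ : ℝ}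
    {q₀ : State S d → ℝ} {sh : ℝ → State S d → State S d → ℝ≥0} {ε C : ℝ≥0}
    {F : Measure (Path (State S d) T)} {Q P : Measure (Path (State S d) (T - δ))}
    (hq : q₀ ∈ stdSimplex ℝ (State S d)) (hF : IsCTMC q₀ (uniformRate S d) F)
    (hQ : IsTimeReversal F Q) (hP : IsTauLeaping T t sh P) (hδ : 0 ≤ δ) (hN : 0 < N)
    (ht : StrictMono t) (ht0 : t 0 = 0) (htN : t (Fin.last N) = T - δ)
    (hε : aggregatedLoss q₀ T t sh = ε)
    (hkl : InformationTheory.klDiv Q P ≤ (ε : ℝ≥0∞) + C) :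
    relEntropy q₀ δ - ∑ k : Fin N, (t k.succ - t k.castSucc) *
      fisherInfo q₀ (T - t k.castSucc) ≤ C := by
  have hh : ∀ k : Fin N, 0 < t k.succ - t k.castSucc := fun k =>
    sub_pos.2 (ht Fin.castSucc_lt_succ)
  have hu : ∀ k : Fin N, 0 < T - t k.castSucc := fun k => by
    have := ht (Fin.castSucc_lt_last k)
    rw [htN] at this
    linarith
  have hτ0 : 0 ≤ T - δ := by
    rw [← htN, ← ht0]
    exact ht.monotone (Fin.zero_le _)
  obtain ⟨hpos, hsum⟩ := aggregatedLoss_eq_sum hq ht hu hε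
  have hkl_top : InformationTheory.klDiv Q P ≠ ⊤ :=
    ne_top_of_le_ne_top (by simp) hkl
  have hkl_real : (InformationTheory.klDiv Q P).toReal ≤ ε + C := by
    have := ENNReal.toReal_mono (by simp) hkl
    rwa [ENNReal.toReal_add (by simp) (by simp)] at this
  set a := extendedSchedule t with ha
  have hmono := monotone_extendedSchedule ht
  have hη : ∀ k : Fin N, Tendsto (fun M : ℕ => (t k.succ - t k.castSucc) / M) atTop (𝓝[>] 0) := by
    intro k
    refine tendsto_nhdsWithin_iff.2 ⟨tendsto_const_div_atTop_nhds_zero_nat _, ?_⟩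
    filter_upwards [eventually_gt_atTop 0] with M hM
    exact div_pos (hh k) (by exact_mod_cast hM)
  have hev : ∀ᶠ M : ℕ in atTop, ∀ k : Fin N, ∀ z i c,
      0 < leapLaw (sh (T - t k.castSucc)) z i ((t k.succ - t k.castSucc) / M) c :=
    eventually_all.2 fun k => (hη k).eventually (eventually_leapLaw_pos (hpos k))
  have hlim : Tendsto (fun M : ℕ => relEntropy q₀ δ + ∑ k : Fin N, (M : ℝ) *
      leapGain q₀ (T - t k.castSucc) (sh (T - t k.castSucc)) ((t k.succ - t k.castSucc) / M))
      atTop (𝓝 (relEntropy q₀ δ + ∑ k : Fin N, (t k.succ - t k.castSucc) *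
        (realScoreLoss q₀ (T - t k.castSucc) (sh (T - t k.castSucc))
          - fisherInfo q₀ (T - t k.castSucc)))) := by
    refine tendsto_const_nhds.add (tendsto_finsetSum _ fun k _ => ?_)
    refine (((tendsto_leapGain_div (hpos k)).comp (hη k)).const_mul
      (t k.succ - t k.castSucc)).congr' ?_
    filter_upwards [eventually_gt_atTop 0] with M hM
    have hM' : (M : ℝ) ≠ 0 := by exact_mod_cast hM.ne'
    have := (hh k).ne'
    simp only [Function.comp_apply]
    field_simp
  have hbound : ∀ᶠ M : ℕ in atTop, relEntropy q₀ δ + ∑ k : Fin N, (M : ℝ) *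
      leapGain q₀ (T - t k.castSucc) (sh (T - t k.castSucc)) ((t k.succ - t k.castSucc) / M)
      ≤ ε + C := by
    filter_upwards [hev, eventually_gt_atTop 0] with M hM hM0
    refine le_trans ?_ hkl_real
    -- The projection only serves to make `g` take values in the time interval; it changes nothing
    -- up to index `M * N`.
    let g : ℕ → Set.Icc (0 : ℝ) (T - δ) := fun j => Set.projIcc 0 (T - δ) hτ0 (refinedTime a M j)
    have hgm : Monotone g := (Set.monotone_projIcc hτ0).comp (monotone_refinedTime hmono hM0)
    have hr0 : refinedTime a M 0 = 0 := by
      have := refinedTime_mul a hM0 0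
      rw [mul_zero] at this
      rw [this, ha, extendedSchedule_zero, ht0]
    have hrN : refinedTime a M (M * N) = T - δ := by
      rw [refinedTime_mul a hM0, ha, extendedSchedule_last, htN]
    have hg : ∀ j ≤ M * N, (g j : ℝ) = refinedTime a M j := fun j hj => by
      have h1 := monotone_refinedTime hmono hM0 (Nat.zero_le j)
      have h2 := monotone_refinedTime hmono hM0 hj
      rw [← ha] at h1 h2
      rw [hr0] at h1
      rw [hrN] at h2
      simp only [g, Set.projIcc_of_mem hτ0 ⟨h1, h2⟩]
    let ℓ : ℕ → Fin N := fun j => if h : j / M < N then ⟨j / M, h⟩ else ⟨0, hN⟩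
    have hℓ : ∀ j < M * N, ((ℓ j : Fin N) : ℕ) = j / M := fun j hj => by
      have : j / M < N := Nat.div_lt_of_lt_mul hj
      simp only [ℓ, dif_pos this]
    have hdiff : ∀ j < M * N, (g (j + 1) : ℝ) - g j
        = (t (ℓ j).succ - t (ℓ j).castSucc) / M := fun j hj => by
      rw [hg _ hj, hg _ hj.le, refinedTime_succ_sub a hM0, ← hℓ j hj, ha, extendedSchedule_succ,
        extendedSchedule_castSucc]
    have hmain := relEntropy_add_sum_leapGain_le hq hF hQ hP hkl_top (by linarith)
      (by linarith : T - δ ≤ T) hgm (by rw [hg 0 (Nat.zero_le _), hr0]) (M * N)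
      -- Rounding `j` down to a multiple of `M` gives the grid index at which the current leap
      -- starts.
      (by rw [hg _ le_rfl, hrN]) (fun j => M * (j / M)) ℓ
      (fun j hj => by
        rw [← sub_pos, hdiff j hj]
        exact div_pos (hh _) (by exact_mod_cast hM0))
      (fun j _ => Nat.mul_div_le j M)
      (fun j hj => by
        rw [hg _ ((Nat.mul_div_le j M).trans hj.le), refinedTime_mul a hM0, ← hℓ j hj, ha,
          extendedSchedule_castSucc])
      (fun j hj => by
        rw [hg _ hj, ← extendedSchedule_succ (t := t), hℓ j hj]
        exact refinedTime_succ_le hmono hM0 j)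
      (fun j hj z i c => by
        rw [hdiff j hj]
        exact hM (ℓ j) z i c)
    rw [sub_sub_cancel] at hmain
    refine le_trans (le_of_eq ?_) hmain
    congr 1
    have hfk : ∀ k : Fin N, (M : ℝ) * leapGain q₀ (T - t k.castSucc) (sh (T - t k.castSucc))
        ((t k.succ - t k.castSucc) / M) = (M : ℝ) * leapGain q₀ (T - a k) (sh (T - a k))
        ((a (k + 1) - a k) / M) := fun k => by
      rw [ha, extendedSchedule_castSucc, extendedSchedule_succ]
    rw [Finset.sum_congr rfl fun k _ => hfk k,
      ← Finset.sum_range fun k => (M : ℝ) * leapGain q₀ (T - a k) (sh (T - a k))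
        ((a (k + 1) - a k) / M),
      ← sum_range_mul_comp_div (fun k => leapGain q₀ (T - a k) (sh (T - a k))
        ((a (k + 1) - a k) / M)) hM0]
    refine Finset.sum_congr rfl fun j hj => ?_
    rw [Finset.mem_range] at hj
    rw [hdiff j hj, ← extendedSchedule_castSucc (t := t), ← extendedSchedule_succ (t := t), hℓ j hj]
  have hfinal := le_of_tendsto hlim hbound
  simp only [mul_sub, Finset.sum_sub_distrib, hsum] at hfinal
  linarith

end

end UniformDiffusion

end

theorem theorem2 (γ₀ δ₀ : ℝ) (C : ℝ≥0) (hγ₀ : 0 < γ₀) (hδ₀ : δ₀ < 1) :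
    ∃ c : ℝ, 0 < c ∧
      ∀ (S d : ℕ) [NeZero S] (γ : ℝ), γ₀ ≤ γ → γ ≤ 1 →
      ∀ q₀ ∈ UniformDiffusion.lowEntropyClass S d γ,
      ∀ (T δ : ℝ), 0 ≤ δ → δ ≤ δ₀ →
      ∀ (N : ℕ) (t : Fin (N + 1) → ℝ), 0 < N → StrictMono t → t 0 = 0 →
        t (Fin.last N) = T - δ → (∀ k : Fin N, t k.succ - t k.castSucc ≤ 1 / 2) →
      ∀ (sh : ℝ → UniformDiffusion.State S d → UniformDiffusion.State S d → ℝ≥0)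
        (εscore : ℝ≥0), UniformDiffusion.aggregatedLoss q₀ T t sh = (εscore : ℝ≥0∞) →
      ∀ (F : Measure (UniformDiffusion.Path (UniformDiffusion.State S d) T))
        (Q P : Measure (UniformDiffusion.Path (UniformDiffusion.State S d) (T - δ))),
        UniformDiffusion.IsCTMC q₀ (UniformDiffusion.uniformRate S d) F →
        UniformDiffusion.IsTimeReversal F Q →
        UniformDiffusion.IsTauLeaping T t sh P →
        InformationTheory.klDiv Q P ≤ (εscore : ℝ≥0∞) + (C : ℝ≥0∞) →
        c * ((d : ℝ) * Real.log S) ≤ (N : ℝ) := by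
  -- The constant of `card_steps_ge` with `γ₀` for `γ`, allowed because H(1) ≥ γL ≥ γ₀L.
  refine ⟨γ₀ * min 1 γ₀ / (4 * (C + 1)), ?_, ?_⟩
  · have := lt_min one_pos hγ₀
    positivity
  intro S d _ γ hγ _ q₀ hq T δ hδ hδδ₀ N t hN ht ht0 htN _ sh ε hε F Q P hF hQ hP hkl
  have hgap := UniformDiffusion.relEntropy_sub_sum_fisherInfo_le hq.1 hF hQ hP hδ hN ht ht0 htN
    hε hkl
  have hlast : T - UniformDiffusion.extendedSchedule t N = δ := by
    rw [UniformDiffusion.extendedSchedule_last, htN, sub_sub_cancel]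
  refine UniformDiffusion.card_steps_ge hq.1 hγ₀ C.2 ?_ hN
    (fun k => T - UniformDiffusion.extendedSchedule t k) ?_ ?_ ?_ ?_
  · have hL : 0 ≤ (d : ℝ) * Real.log S := mul_nonneg (by positivity) (Real.log_natCast_nonneg S)
    have h1 := hq.2
    have h2 := mul_le_mul_of_nonneg_right hγ hL
    rw [UniformDiffusion.relEntropy]
    linarith
  · intro k hk
    have h1 := UniformDiffusion.extendedSchedule_castSucc (t := t) ⟨k, hk⟩
    have h2 := UniformDiffusion.extendedSchedule_succ (t := t) ⟨k, hk⟩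
    have h3 := ht (Fin.castSucc_lt_succ (i := ⟨k, hk⟩))
    simp only at h1 h2
    rw [h1, h2]
    linarith
  · simp only [hlast]
    exact hδ
  -- The last level is `δ ≤ δ₀ < 1`, so the schedule descends below level 1 and must spend all the
  -- entropy held there.
  · simp only [hlast]
    linarith
  · simp only [hlast]
    rw [Finset.sum_range]
    refine le_trans (le_of_eq ?_) hgap
    congr 1
    refine Finset.sum_congr rfl fun k _ => ?_
    rw [UniformDiffusion.extendedSchedule_castSucc, UniformDiffusion.extendedSchedule_succ]
    ring
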